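/- **Setting.** Let $\mathcal Y=[a,b]$ and let $\ell:\mathcal Y\times\mathcal Y\to\mathbb R$ be a SELF loss, i.e. $\ell(y,y')=\langle\psi(y),V\psi(y')\rangle_{\mathcal H}$ for all $y,y'$, where $\mathcal H$ is a real Hilbert space, $\psi:\mathcal Y\to\mathcal H$ is continuous and $V:\mathcal H\to\mathcal H$ is a bounded linear operator. Let $\mathcal X$ be a measurable space and $\mathcal G$ a separable reproducing kernel Hilbert space of real functions on $\mathcal X$ whose kernel $k$ is bounded ($\sup_x k(x,x)<\infty$) and such that every $k(x,\cdot)$ is measurable. Let $\mathcal H\otimes\mathcal G$ be the Hilbert tensor product, viewed as a space of functions $\mathcal X\to\mathcal H$ through $(h\otimes g)(x)=g(x)h$. Fix $R\in\mathbb R$. For $T$ tasks, let $\rho_{\mathcal X}$ be a probability measure on $\mathcal X$ and, for $t=1,\dots,T$, let $\rho_t(x,y)=\rho_t(y|x)\rho_{\mathcal X}(x)$ be a probability measure on $\mathcal X\times\mathcal Y$; put $g_t^*(x)=\int_{\mathcal Y}\psi(y)\,d\rho_t(y|x)$. For a constraint set $\mathcal C\subseteq\mathcal Y^T$ and a measurable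 $f:\mathcal X\to\mathcal C$ let $$\mathcal E(f)=\frac1T\sum_{t=1}^T\int_{\mathcal X\times\mathcal Y}\ell(f_t(x),y)\,d\rho_t(x,y),\qquad q_{\mathcal C,\ell,T}=2\sup_{c\in\mathcal C}\sqrt{\frac1T\sum_{t=1}^T\|V^*\psi(c_t)\|_{\mathcal H}^2}.$$ For each $t$ let $(x_{it},y_{it})_{i=1}^{n_t}$, $n_t\ge1$, be independently sampled from $\rho_t$; let $N=(n_1,\dots,n_T)$, $n_0=\min_t n_t$ and $\lambda_t=n_t^{-1/2}$. The nonlinear MTL estimator $\widehat f_N:\mathcal X\to\mathcal C$ is a measurable function such that for all $x\in\mathcal X$ $$\widehat f_N(x)\in\operatorname*{argmin}_{c\in\mathcal C}\sum_{t=1}^T\sum_{i=1}^{n_t}\alpha_{it}(x)\,\ell(c_t,y_{it}),\qquad (\alpha_{1t}(x),\dots,\alpha_{n_tt}(x))^\top=(K_t+n_t\lambda_tI)^{-1}K_{tx},$$ where $(K_t)_{ij}=k(x_{it},x_{jt})$ and $(K_{tx})_i=k(x,x_{it})$. **Theorem (generalization bound).** There is a constant $h_\ell>0$, which may depend on $\ell$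 (with $\psi,V$), on $k$ and on $R$ but not on $T$, $\mathcal C$, $N$, $\lambda_t$, $\tau$ or the distributions, such that the following holds for every $T\ge2$. Assume that for every $t=1,\dots,T$, $g_t^*$ coincides $\rho_{\mathcal X}$-almost everywhere with an element of $\mathcal H\otimes\mathcal G$ of norm at most $R$. Then for every $\tau>0$, with probability at least $1-8e^{-\tau}$, $$\mathcal E(\widehat f_N)-\inf_{f:\mathcal X\to\mathcal C}\mathcal E(f)\;\le\;q_{\mathcal C,\ell,T}\;h_\ell\;\tau^2\;n_0^{-1/4}\,\log T,$$ where the infimum is over measurable $f:\mathcal X\to\mathcal C$. -/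

import Mathlib

open MeasureTheory ProbabilityTheory
open scoped TensorProduct

noncomputable section

namespace NonlinearMTL

/-- `ℓ(y, y') = ⟪ψ(y), V ψ(y')⟫` with `ψ` continuous and `V` a bounded linear operator: the loss `ℓ`
on the compact interval `[a, b]` is a structure encoding loss function (SELF), with feature map `ψ`
and operator `V`. -/
structure IsSELF {a b : ℝ} {H : Type*} [NormedAddCommGroup H] [InnerProductSpace ℝ H]
    (ℓ : Set.Icc a b → Set.Icc a b → ℝ) (ψ : Set.Icc a b → H) (V : H →L[ℝ] H) : Prop where
  continuous_feature : Continuous ψ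
  loss_eq : ∀ y y', ℓ y y' = inner ℝ (ψ y) (V (ψ y'))

/-- The multitask expected risk `(1/T) ∑ₜ ∫ ℓ(fₜ(x), y) dρₜ(x, y)`. -/
def expectedRisk {X Y : Type*} [MeasurableSpace X] [MeasurableSpace Y] {T : ℕ} (ℓ : Y → Y → ℝ)
    (ρ : Fin T → Measure (X × Y)) (f : X → Fin T → Y) : ℝ :=
  (T : ℝ)⁻¹ * ∑ t, ∫ z, ℓ (f z.1 t) z.2 ∂(ρ t)

/-- The infimum of the expected risk over all measurable `f : X → C`. -/
def optimalRisk {X Y : Type*} [MeasurableSpace X] [MeasurableSpace Y] {T : ℕ} (ℓ : Y → Y → ℝ)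
    (ρ : Fin T → Measure (X × Y)) (C : Set (Fin T → Y)) : ℝ :=
  ⨅ f : {f : X → Fin T → Y // Measurable f ∧ ∀ x, f x ∈ C}, expectedRisk ℓ ρ f.1

/-- The scalar reproducing kernel `k(x, x')` of a reproducing kernel Hilbert space `G` of real
functions on `X`. -/
def scalarKernel {X : Type*} (G : Type*) [NormedAddCommGroup G] [InnerProductSpace ℝ G]
    [CompleteSpace G] [RKHS ℝ G X ℝ] (x x' : X) : ℝ :=
  RKHS.kernel G x x' 1

/-- The Hilbert tensor product `H ⊗ G`, the completion of the algebraic tensor product for the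
inner product `⟪h ⊗ g, h' ⊗ g'⟫ = ⟪h, h'⟫ ⟪g, g'⟫`. -/
abbrev HilbertTensor (H G : Type*) [NormedAddCommGroup H] [InnerProductSpace ℝ H]
    [NormedAddCommGroup G] [InnerProductSpace ℝ G] : Type _ :=
  UniformSpace.Completion (H ⊗[ℝ] G)

/-- An element `w` of `H ⊗ G`, with `G` a space of real functions on `X`, as a function `X → H`:
this is the continuous linear extension of `h ⊗ g ↦ (x ↦ g(x) h)`. -/
def tensorEval {X : Type*} {H G : Type*} [NormedAddCommGroup H] [InnerProductSpace ℝ H]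
    [CompleteSpace H] [NormedAddCommGroup G] [InnerProductSpace ℝ G] [RKHS ℝ G X ℝ] (x : X) :
    HilbertTensor H G →L[ℝ] H :=
  ((TensorProduct.ridIsometry ℝ H).toContinuousLinearEquiv.toContinuousLinearMap ∘L
    ((ContinuousLinearMap.proj (R := ℝ) (φ := fun _ : X => ℝ) x ∘L
      RKHS.coeCLM ℝ (H := G)).lTensor H)).extend UniformSpace.Completion.toComplL

theorem tensorEval_tmul {X : Type*} {H G : Type*} [NormedAddCommGroup H] [InnerProductSpace ℝ H]
    [CompleteSpace H] [NormedAddCommGroup G] [InnerProductSpace ℝ G] [RKHS ℝ G X ℝ] (x : X)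
    (h : H) (g : G) :
    tensorEval x ((h ⊗ₜ[ℝ] g : H ⊗[ℝ] G) : HilbertTensor H G) = g x • h := by
  unfold tensorEval
  have := ContinuousLinearMap.extend_eq
    (((TensorProduct.ridIsometry ℝ H).toContinuousLinearEquiv.toContinuousLinearMap ∘L
    ((ContinuousLinearMap.proj (R := ℝ) (φ := fun _ : X => ℝ) x ∘L
      RKHS.coeCLM ℝ (H := G)).lTensor H)))
    (e := UniformSpace.Completion.toComplL (𝕜 := ℝ) (E := H ⊗[ℝ] G))
    (UniformSpace.Completion.denseRange_coe) (UniformSpace.Completion.isUniformInducing_coe _)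
    (h ⊗ₜ[ℝ] g)
  simpa using this

/-- The weights `α(x) = (K + n λ I)⁻¹ Kₓ` of kernel ridge regression with kernel `k`, inputs
`xs 0, …, xs (n - 1)` and regularization parameter `reg`. -/
def krrWeights {X : Type*} {n : ℕ} (k : X → X → ℝ) (xs : Fin n → X) (reg : ℝ) (x : X) :
    Fin n → ℝ :=
  ((Matrix.of fun i j => k (xs i) (xs j)) + ((n : ℝ) * reg) • (1 : Matrix (Fin n) (Fin n) ℝ))⁻¹.mulVec
    fun i => k x (xs i)

/-- `f : X → C` is a nonlinear multitask estimator for the data `z t i = (xᵢₜ, yᵢₜ)`: for every `x`,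
`f x` minimizes `∑ₜ ∑ᵢ αᵢₜ(x) ℓ(cₜ, yᵢₜ)` over `c ∈ C`. -/
def IsMTLEstimator {X Y : Type*} {T : ℕ} {n : Fin T → ℕ} (ℓ : Y → Y → ℝ) (k : X → X → ℝ)
    (reg : Fin T → ℝ) (C : Set (Fin T → Y)) (z : (t : Fin T) → Fin (n t) → X × Y)
    (f : X → Fin T → Y) : Prop :=
  ∀ x, f x ∈ C ∧
    IsMinOn (fun c : Fin T → Y =>
      ∑ t, ∑ i, krrWeights k (fun j => (z t j).1) (reg t) x i * ℓ (c t) (z t i).2) C (f x)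

/-- The constant `q = 2 sup_{c ∈ C} √((1/T) ∑ₜ ‖V* ψ(cₜ)‖²)`. -/
def qConst {Y H : Type*} [NormedAddCommGroup H] [InnerProductSpace ℝ H] [CompleteSpace H] {T : ℕ}
    (ψ : Y → H) (V : H →L[ℝ] H) (C : Set (Fin T → Y)) : ℝ :=
  2 * ⨆ c : C, √((T : ℝ)⁻¹ * ∑ t, ‖ContinuousLinearMap.adjoint V (ψ (c.1 t))‖ ^ 2)

end NonlinearMTL

end

noncomputable section

namespace NonlinearMTL

/-! Because the loss is linear in `ψ y'`, the risk sees each task only through its regression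
function `w t`, and the estimator minimizes the same functional with `w t` replaced by a kernel
ridge estimate. Comparing the two functionals at two points of `C` costs a Cauchy–Schwarz bound each
time, hence the 2 in `qConst`, and leaves the `L²(ρX)` errors of the ridge regressions
(`expectedRisk_sub_optimalRisk_le`).

For one task, testing the normal equation against the error `v` bounds `‖v‖` and the empirical `L²`
norm of `v` by the noise `∑ k(xᵢ, ·) ⊗ (ψ yᵢ - w xᵢ)`. Passing to the population norm needs
uniformity in `v`, which depends on the data. The operators `id ⊗ (k(x, ·) ⊗ k(x, ·))` are in
general not Hilbert–Schmidt when `H` is infinite dimensional, so `H` is traced out first: the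
quadratic form of `v` becomes a linear functional on `G ⊗ G` of norm at most `‖v‖ ^ 2`, and only the
mean of `k(x, ·) ⊗ k(x, ·)` must concentrate. Noise and mean are sums of bounded centred independent
vectors of a Hilbert space, covered by one dimension-free Hoeffding inequality. The squared error is
thus of order `τ ^ 2 * n ^ (-1/2)`.

A union bound over tasks replaces `τ` by `τ + log T`, which yields the factor `log T`. -/

/-! ### Hoeffding's inequality in Hilbert space, with `cosh ‖·‖` in place of the exponential moment.
-/

theorem exp_le_add_exp_sq {x : ℝ} (hx : 0 ≤ x) : Real.exp x ≤ x + Real.exp (x ^ 2) := by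
  rcases le_total x 1 with h | h
  · have h1 := abs_le.mp (Real.abs_exp_sub_one_sub_id_le (x := x) (by rwa [abs_of_nonneg hx]))
    have h2 := Real.add_one_le_exp (x ^ 2)
    linarith [h1.2]
  · have : Real.exp x ≤ Real.exp (x ^ 2) := Real.exp_le_exp.mpr (by nlinarith)
    linarith

/-- The series `cosh √s = ∑ s ^ k / (2k)!` has nonnegative coefficients, so convexity in `s` holds
term by term. -/
theorem cosh_sqrt_convex {p q u v r : ℝ} (hp : 0 ≤ p) (hq : 0 ≤ q) (hpq : p + q = 1)
    (h : r ^ 2 = p * u ^ 2 + q * v ^ 2) :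
    Real.cosh r ≤ p * Real.cosh u + q * Real.cosh v := by
  refine hasSum_le (fun k => ?_) (Real.hasSum_cosh r)
    (((Real.hasSum_cosh u).mul_left p).add ((Real.hasSum_cosh v).mul_left q))
  have hc := (convexOn_pow (𝕜 := ℝ) k).2 (Set.mem_Ici.mpr (sq_nonneg u))
    (Set.mem_Ici.mpr (sq_nonneg v)) hp hq hpq
  simp only [smul_eq_mul] at hc
  rw [← h, ← pow_mul, ← pow_mul, ← pow_mul] at hc
  have h3 := div_le_div_of_nonneg_right hc (Nat.cast_nonneg (α := ℝ) (Nat.factorial (2 * k)))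
  calc _ ≤ _ := h3
    _ = _ := by ring

theorem norm_cosh_le {r s : ℝ} (hr : 0 ≤ r) (h : r ≤ s) : ‖Real.cosh r‖ ≤ Real.cosh s := by
  rw [Real.norm_of_nonneg (Real.cosh_pos r).le, Real.cosh_le_cosh, abs_of_nonneg hr]
  exact h.trans (le_abs_self _)

section Hilbert

variable {E : Type*} [NormedAddCommGroup E] [InnerProductSpace ℝ E]

/-- By the law of cosines, `‖x + y‖ ^ 2` is the mean of `(‖x‖ ± ‖y‖) ^ 2` with weights `(1 ± c) /
2`, where `c` is the cosine of the angle; convexity of `cosh √·` and the addition formulas do the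
rest. -/
theorem cosh_norm_add_le (x y : E) :
    Real.cosh ‖x + y‖ ≤ Real.cosh ‖x‖ * Real.cosh ‖y‖
      + Real.sinh ‖x‖ / ‖x‖ * (Real.sinh ‖y‖ / ‖y‖) * inner ℝ x y := by
  rcases eq_or_ne x 0 with rfl | hx
  · simp
  rcases eq_or_ne y 0 with rfl | hy
  · simp
  have hx' : 0 < ‖x‖ := norm_pos_iff.mpr hx
  have hy' : 0 < ‖y‖ := norm_pos_iff.mpr hy
  set c : ℝ := inner ℝ x y / (‖x‖ * ‖y‖) with hc
  have hci : inner ℝ x y = c * (‖x‖ * ‖y‖) := by rw [hc]; field_simp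
  have hc1 := abs_le.mp (abs_real_inner_div_norm_mul_norm_le_one x y)
  have key := cosh_sqrt_convex (p := (1 + c) / 2) (q := (1 - c) / 2) (u := ‖x‖ + ‖y‖)
    (v := ‖x‖ - ‖y‖) (r := ‖x + y‖) (by linarith [hc1.1]) (by linarith [hc1.2]) (by ring)
    (by rw [norm_add_sq_real, hci]; ring)
  rw [Real.cosh_add, Real.cosh_sub] at key
  refine key.trans (le_of_eq ?_)
  rw [hci]
  field_simp
  ring

/-- The last term is made linear in `y`, so that it vanishes on averaging over centred `y`.
Replacing `sinh ‖y‖ / ‖y‖` by 1 costs at most `cosh ‖x‖ * (sinh ‖y‖ - ‖y‖)`, and `cosh r + sinh r -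
r = exp r - r ≤ exp (r ^ 2)`. -/
theorem cosh_norm_add_le_exp (x y : E) :
    Real.cosh ‖x + y‖ ≤ Real.cosh ‖x‖ * Real.exp (‖y‖ ^ 2)
      + Real.sinh ‖x‖ / ‖x‖ * inner ℝ x y := by
  refine (cosh_norm_add_le x y).trans ?_
  have hs : Real.sinh ‖x‖ / ‖x‖ * ((Real.sinh ‖y‖ / ‖y‖ - 1) * inner ℝ x y) ≤
      Real.cosh ‖x‖ * (Real.sinh ‖y‖ - ‖y‖) := by
    rcases eq_or_ne x 0 with rfl | hx
    · simp
    rcases eq_or_ne y 0 with rfl | hy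
    · simp
    have hx' : 0 < ‖x‖ := norm_pos_iff.mpr hx
    have hy' : 0 < ‖y‖ := norm_pos_iff.mpr hy
    have h1 : 0 ≤ Real.sinh ‖y‖ / ‖y‖ - 1 := by
      rw [sub_nonneg, le_div_iff₀ hy', one_mul]; exact Real.self_le_sinh_iff.mpr hy'.le
    have h2 : 0 ≤ Real.sinh ‖x‖ / ‖x‖ := div_nonneg (Real.sinh_nonneg_iff.mpr hx'.le) hx'.le
    calc _ ≤ Real.sinh ‖x‖ / ‖x‖ * ((Real.sinh ‖y‖ / ‖y‖ - 1) * (‖x‖ * ‖y‖)) := by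
          gcongr; exact real_inner_le_norm x y
      _ = Real.sinh ‖x‖ * (Real.sinh ‖y‖ - ‖y‖) := by field_simp
      _ ≤ _ := by
          gcongr
          · linarith [Real.self_le_sinh_iff.mpr hy'.le]
          · exact (Real.sinh_lt_cosh _).le
  have he : Real.cosh ‖x‖ * (Real.cosh ‖y‖ + Real.sinh ‖y‖ - ‖y‖) ≤
      Real.cosh ‖x‖ * Real.exp (‖y‖ ^ 2) := by
    refine mul_le_mul_of_nonneg_left ?_ (Real.cosh_pos _).le
    rw [Real.cosh_add_sinh]
    linarith [exp_le_add_exp_sq (norm_nonneg y)]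
  nlinarith

theorem integral_cosh_norm_add_le [CompleteSpace E] {α : Type*} [MeasurableSpace α]
    {μ : Measure α} [IsProbabilityMeasure μ]
    {φ : α → E} (hφ : StronglyMeasurable φ) {M : ℝ} (hM : ∀ z, ‖φ z‖ ≤ M)
    (h0 : ∫ z, φ z ∂μ = 0) (x : E) :
    ∫ z, Real.cosh ‖x + φ z‖ ∂μ ≤ Real.cosh ‖x‖ * Real.exp (M ^ 2) := by
  have hint : Integrable φ μ := .of_bound hφ.aestronglyMeasurable M (.of_forall hM)
  have hint' : Integrable (fun z => Real.cosh ‖x + φ z‖) μ := by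
    refine .of_bound (C := Real.cosh (‖x‖ + M)) ?_ (.of_forall fun z => ?_)
    · exact (Real.continuous_cosh.comp_stronglyMeasurable
        (stronglyMeasurable_const.add hφ).norm).aestronglyMeasurable
    · exact norm_cosh_le (norm_nonneg _) ((norm_add_le _ _).trans (add_le_add_right (hM z) _))
  calc ∫ z, Real.cosh ‖x + φ z‖ ∂μ
      ≤ ∫ z, (Real.cosh ‖x‖ * Real.exp (M ^ 2) + Real.sinh ‖x‖ / ‖x‖ * inner ℝ x (φ z)) ∂μ := by
        refine integral_mono hint' ?_ fun z => (cosh_norm_add_le_exp x (φ z)).trans ?_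
        · exact (integrable_const _).add ((hint.const_inner x).const_mul _)
        · have := hM z
          have := (Real.cosh_pos ‖x‖).le
          gcongr
    _ = _ := by
        rw [integral_add (integrable_const _) ((hint.const_inner x).const_mul _),
          integral_const_mul _ (fun z => inner ℝ x (φ z)), integral_inner hint, h0]
        simp

theorem integral_cosh_norm_sum_le [CompleteSpace E] {α : Type*} [MeasurableSpace α]
    {μ : Measure α} [IsProbabilityMeasure μ]
    {φ : α → E} (hφ : StronglyMeasurable φ) {M : ℝ} (hM : ∀ z, ‖φ z‖ ≤ M)
    (h0 : ∫ z, φ z ∂μ = 0) (n : ℕ) :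
    ∫ z, Real.cosh ‖∑ i, φ (z i)‖ ∂(Measure.pi fun _ : Fin n => μ) ≤ Real.exp (n * M ^ 2) := by
  have hmeas (m : ℕ) : StronglyMeasurable fun z : Fin m → α => ∑ i, φ (z i) :=
    Finset.stronglyMeasurable_fun_sum _ fun i _ => hφ.comp_measurable (measurable_pi_apply i)
  have hb (m : ℕ) (z : Fin m → α) : ‖∑ i, φ (z i)‖ ≤ m * M := by
    refine (norm_sum_le _ _).trans ((Finset.sum_le_sum fun i _ => hM (z i)).trans ?_)
    simp
  induction n with
  | zero => simp
  | succ n ih =>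
    have hmp := measurePreserving_piFinSuccAbove (fun _ : Fin (n + 1) => μ) 0
    have h1 : ∫ z, Real.cosh ‖∑ i, φ (z i)‖ ∂(Measure.pi fun _ : Fin (n + 1) => μ) =
        ∫ p, Real.cosh ‖(∑ i, φ (p.2 i)) + φ p.1‖ ∂(μ.prod (Measure.pi fun _ : Fin n => μ)) := by
      rw [← hmp.integral_comp (MeasurableEquiv.measurableEmbedding _)]
      congr 1 with z
      rw [Fin.sum_univ_succ, add_comm]
      rfl
    have hint : Integrable (fun p : α × (Fin n → α) => Real.cosh ‖(∑ i, φ (p.2 i)) + φ p.1‖)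
        (μ.prod (Measure.pi fun _ : Fin n => μ)) := by
      refine .of_bound (C := Real.cosh (n * M + M)) ?_ (.of_forall fun z => ?_)
      · exact (Real.continuous_cosh.comp_stronglyMeasurable
          (((hmeas n).comp_measurable measurable_snd).add
            (hφ.comp_measurable measurable_fst)).norm).aestronglyMeasurable
      · exact norm_cosh_le (norm_nonneg _) ((norm_add_le _ _).trans (add_le_add (hb n _) (hM _)))
    rw [h1, integral_prod_symm _ hint]
    have hint2 : Integrable (fun z : Fin n → α => Real.cosh ‖∑ i, φ (z i)‖)
        (Measure.pi fun _ : Fin n => μ) := by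
      refine .of_bound (C := Real.cosh (n * M)) ?_ (.of_forall fun z => ?_)
      · exact (Real.continuous_cosh.comp_stronglyMeasurable (hmeas n).norm).aestronglyMeasurable
      · exact norm_cosh_le (norm_nonneg _) (hb n _)
    have hmono : ∫ z, ∫ y, Real.cosh ‖(∑ i, φ (z i)) + φ y‖ ∂μ ∂(Measure.pi fun _ : Fin n => μ) ≤
        ∫ z, Real.cosh ‖∑ i, φ (z i)‖ * Real.exp (M ^ 2) ∂(Measure.pi fun _ : Fin n => μ) :=
      integral_mono hint.integral_prod_right (hint2.mul_const (Real.exp (M ^ 2)))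
        fun z => integral_cosh_norm_add_le hφ hM h0 (∑ i, φ (z i))
    refine hmono.trans ?_
    rw [integral_mul_const]
    calc (∫ z, Real.cosh ‖∑ i, φ (z i)‖ ∂(Measure.pi fun _ : Fin n => μ)) * Real.exp (M ^ 2)
        ≤ Real.exp (n * M ^ 2) * Real.exp (M ^ 2) := by gcongr
      _ = _ := by rw [← Real.exp_add]; push_cast; ring_nf

/-- A Hoeffding inequality for sums of independent bounded random vectors of a Hilbert space. -/
theorem measureReal_norm_sum_gt_le [CompleteSpace E] {α Ω : Type*} [MeasurableSpace α]
    [MeasurableSpace Ω] {P : Measure Ω} [IsProbabilityMeasure P] {n : ℕ} (hn : 1 ≤ n)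
    {Z : Fin n → Ω → α} (hZ : ∀ i, Measurable (Z i)) {μ : Measure α} [IsProbabilityMeasure μ]
    (hlaw : ∀ i, P.map (Z i) = μ) (hind : iIndepFun Z P)
    {φ : α → E} (hφ : StronglyMeasurable φ) {M : ℝ} (hM0 : 0 < M) (hM : ∀ z, ‖φ z‖ ≤ M)
    (h0 : ∫ z, φ z ∂μ = 0) {τ : ℝ} (hτ : 0 ≤ τ) :
    P.real {ω | 2 * M * √(n * τ) < ‖∑ i, φ (Z i ω)‖} ≤ 2 * Real.exp (-τ) := by
  have hn' : (0 : ℝ) < n := by exact_mod_cast hn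
  -- With this scale the moment bound `exp (n * (θ * M) ^ 2)` is `exp τ`, while the threshold
  -- becomes `2 * τ`; Markov's inequality then gives `2 * exp τ / exp (2 * τ)`.
  set θ : ℝ := √(τ / n) / M with hθ
  have hθ0 : 0 ≤ θ := by positivity
  have hJ : P.map (fun ω i => Z i ω) = Measure.pi fun _ : Fin n => μ := by
    rw [(iIndepFun_iff_map_fun_eq_pi_map fun i => (hZ i).aemeasurable).mp hind]
    simp_rw [hlaw]
  have hZm : Measurable fun ω i => Z i ω := measurable_pi_lambda _ hZ
  have hsum : StronglyMeasurable fun z : Fin n → α => ∑ i, θ • φ (z i) :=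
    Finset.stronglyMeasurable_fun_sum _ fun i _ =>
      (hφ.comp_measurable (measurable_pi_apply i)).const_smul θ
  have hcm : StronglyMeasurable fun z : Fin n → α => Real.cosh ‖∑ i, θ • φ (z i)‖ :=
    Real.continuous_cosh.comp_stronglyMeasurable hsum.norm
  have hE : ∫ ω, Real.cosh ‖∑ i, θ • φ (Z i ω)‖ ∂P ≤ Real.exp (n * (θ * M) ^ 2) := by
    have h1 := integral_cosh_norm_sum_le (μ := μ) (φ := fun z => θ • φ z) (M := θ * M)
      (hφ.const_smul θ) (fun z => by
        rw [norm_smul, Real.norm_of_nonneg hθ0]; exact mul_le_mul_of_nonneg_left (hM z) hθ0)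
      (by rw [integral_smul, h0, smul_zero]) n
    rw [← hJ, integral_map hZm.aemeasurable hcm.aestronglyMeasurable] at h1
    exact h1
  have hint : Integrable (fun ω => Real.cosh ‖∑ i, θ • φ (Z i ω)‖) P := by
    refine .of_bound (C := Real.cosh (n * (θ * M))) ?_ (.of_forall fun ω => ?_)
    · exact (hcm.comp_measurable hZm).aestronglyMeasurable
    · refine norm_cosh_le (norm_nonneg _) ?_
      refine (norm_sum_le _ _).trans ((Finset.sum_le_sum (g := fun _ => θ * M) fun i _ => ?_).trans ?_)
      · rw [norm_smul, Real.norm_of_nonneg hθ0]; exact mul_le_mul_of_nonneg_left (hM _) hθ0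
      · simp
  have hθM : (θ * M) ^ 2 = τ / n := by
    rw [hθ, div_mul_cancel₀ _ hM0.ne', Real.sq_sqrt (by positivity)]
  have hθr : θ * (2 * M * √(n * τ)) = 2 * τ := by
    have : √(τ / n) * √(n * τ) = τ := by
      rw [← Real.sqrt_mul (by positivity), show τ / n * (n * τ) = τ ^ 2 by field_simp,
        Real.sqrt_sq hτ]
    calc θ * (2 * M * √(n * τ)) = 2 * (√(τ / n) * √(n * τ)) := by rw [hθ]; field_simp
      _ = _ := by rw [this]
  have hmk := mul_meas_ge_le_integral_of_nonneg (μ := P)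
    (.of_forall fun ω => (Real.cosh_pos ‖∑ i, θ • φ (Z i ω)‖).le) hint (Real.exp (2 * τ) / 2)
  have hsub : P.real {ω | 2 * M * √(n * τ) < ‖∑ i, φ (Z i ω)‖} ≤
      P.real {ω | Real.exp (2 * τ) / 2 ≤ Real.cosh ‖∑ i, θ • φ (Z i ω)‖} := by
    refine measureReal_mono fun ω hω => ?_
    rw [Set.mem_ofPred_eq] at hω ⊢
    rw [← Finset.smul_sum, norm_smul, Real.norm_of_nonneg hθ0, Real.cosh_eq]
    have : 2 * τ ≤ θ * ‖∑ i, φ (Z i ω)‖ := by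
      rw [← hθr]; exact mul_le_mul_of_nonneg_left hω.le hθ0
    have h1 := Real.exp_le_exp.mpr this
    have h2 := Real.exp_pos (-(θ * ‖∑ i, φ (Z i ω)‖))
    linarith
  refine hsub.trans ?_
  have h2 : Real.exp (2 * τ) / 2 *
      P.real {ω | Real.exp (2 * τ) / 2 ≤ Real.cosh ‖∑ i, θ • φ (Z i ω)‖} ≤ Real.exp τ := by
    refine hmk.trans (hE.trans (le_of_eq ?_))
    rw [hθM]; congr 1; field_simp
  have h3 : Real.exp (2 * τ) = Real.exp τ * Real.exp τ := by rw [← Real.exp_add]; ring_nf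
  rw [h3] at h2 ⊢
  rw [Real.exp_neg]
  have hp := Real.exp_pos τ
  rw [← div_eq_mul_inv, le_div_iff₀ hp]
  nlinarith

end Hilbert

theorem _root_.Orthonormal.countable_index {ι E : Type*} [NormedAddCommGroup E]
    [InnerProductSpace ℝ E] [TopologicalSpace.SeparableSpace E] {b : ι → E}
    (hb : Orthonormal ℝ b) : Countable ι := by
  refine Pairwise.countable_of_isOpen_disjoint (s := fun i => Metric.ball (b i) (1 / 2))
    (fun i j hij => ?_) (fun i => Metric.isOpen_ball)
    (fun i => ⟨b i, Metric.mem_ball_self (by norm_num)⟩)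
  refine Metric.ball_disjoint_ball ?_
  have h : ‖b i - b j‖ ^ 2 = 2 := by
    rw [norm_sub_sq_real, hb.1 i, hb.1 j, hb.2 hij]; norm_num
  rw [dist_eq_norm]
  nlinarith [norm_nonneg (b i - b j)]

/-! ### Hilbert tensor products, contraction and partial trace. -/

section Tensor

variable {H G : Type*} [NormedAddCommGroup H] [InnerProductSpace ℝ H]
  [NormedAddCommGroup G] [InnerProductSpace ℝ G]

/-- The pure tensor `h ⊗ g` in the Hilbert tensor product, as a continuous bilinear map of
`g` and `h`. -/
def tensorRight : G →L[ℝ] H →L[ℝ] HilbertTensor H G :=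
  ((ContinuousLinearMap.compL ℝ G (H ⊗[ℝ] G) (HilbertTensor H G)
    UniformSpace.Completion.toComplL) ∘L TensorProduct.mkL ℝ H G).flip

@[simp]
theorem tensorRight_apply (g : G) (h : H) :
    tensorRight g h = ((h ⊗ₜ[ℝ] g : H ⊗[ℝ] G) : HilbertTensor H G) := rfl

theorem norm_tensorRight_apply (g : G) (h : H) :
    ‖tensorRight (H := H) g h‖ = ‖h‖ * ‖g‖ := by
  rw [tensorRight_apply, UniformSpace.Completion.norm_coe, TensorProduct.norm_tmul]

theorem inner_tensorRight (g g' : G) (h h' : H) :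
    inner ℝ (tensorRight g h) (tensorRight g' h') = inner ℝ h h' * inner ℝ g g' := by
  rw [tensorRight_apply, tensorRight_apply, UniformSpace.Completion.inner_coe,
    TensorProduct.inner_tmul]

theorem norm_tensorRight_le (g : G) : ‖tensorRight (H := H) g‖ ≤ ‖g‖ :=
  ContinuousLinearMap.opNorm_le_bound _ (norm_nonneg _) fun h => by
    rw [norm_tensorRight_apply, mul_comm]

/-- An algebraic tensor is a finite sum of pure tensors with orthonormal first factors. -/
theorem exists_orthonormal_sum_tmul (v : H ⊗[ℝ] G) :
    ∃ (d : ℕ) (e : Fin d → H) (g : Fin d → G), Orthonormal ℝ e ∧ v = ∑ j, e j ⊗ₜ[ℝ] g j := by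
  obtain ⟨E', F', iE', iF', hz⟩ :=
    TensorProduct.exists_finite_submodule_of_setFinite {v} (Set.finite_singleton v)
  obtain ⟨y, rfl⟩ := Set.singleton_subset_iff.mp hz
  have b := stdOrthonormalBasis ℝ E'
  refine ⟨_, fun j => (b j : H), ?_⟩
  have horth : Orthonormal ℝ fun j => (b j : H) :=
    b.orthonormal.comp_linearIsometry E'.subtypeₗᵢ
  suffices h : ∃ g : Fin (Module.finrank ℝ E') → G, TensorProduct.mapIncl E' F' y = ∑ j, (b j : H) ⊗ₜ[ℝ] g j by
    obtain ⟨g, hg⟩ := h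
    exact ⟨g, horth, hg⟩
  clear hz
  induction y using TensorProduct.induction_on with
  | zero => exact ⟨0, by simp⟩
  | tmul x f =>
    refine ⟨fun j => b.repr x j • (f : G), ?_⟩
    simp_rw [← TensorProduct.smul_tmul, ← TensorProduct.sum_tmul]
    have hx : (x : H) = ∑ j, b.repr x j • (b j : H) := by
      conv_lhs => rw [← b.sum_repr x]
      simp
    conv_lhs => rw [TensorProduct.mapIncl, TensorProduct.map_tmul]
    simp only [Submodule.subtype_apply]
    rw [← hx]
  | add y z hy hz =>
    obtain ⟨g, hg⟩ := hy
    obtain ⟨g', hg'⟩ := hz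
    exact ⟨g + g', by simp [hg, hg', TensorProduct.tmul_add, Finset.sum_add_distrib]⟩

end Tensor

section Partial

variable {H G : Type*} [NormedAddCommGroup H] [InnerProductSpace ℝ H] [CompleteSpace H]
  [NormedAddCommGroup G] [InnerProductSpace ℝ G]

/-- Contraction of the second factor with `g`. -/
def contractRight (g : G) : HilbertTensor H G →L[ℝ] H :=
  ContinuousLinearMap.adjoint (tensorRight g)

theorem inner_contractRight (g : G) (v : HilbertTensor H G) (h : H) :
    inner ℝ h (contractRight g v) = inner ℝ (tensorRight g h) v :=
  ContinuousLinearMap.adjoint_inner_right _ _ _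

theorem norm_contractRight_le (g : G) : ‖contractRight (H := H) g‖ ≤ ‖g‖ := by
  rw [contractRight, LinearIsometryEquiv.norm_map]; exact norm_tensorRight_le g

theorem norm_contractRight_apply_le (g : G) (v : HilbertTensor H G) :
    ‖contractRight g v‖ ≤ ‖g‖ * ‖v‖ :=
  (contractRight g).le_of_opNorm_le (norm_contractRight_le g) v

theorem contractRight_tensorRight (g g' : G) (h : H) :
    contractRight g (tensorRight g' h) = inner ℝ g g' • h := by
  refine ext_inner_left ℝ fun h' => ?_
  rw [inner_contractRight, inner_tensorRight, inner_smul_right, mul_comm]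

theorem continuous_contractRight : Continuous (contractRight : G → HilbertTensor H G →L[ℝ] H) :=
  ContinuousLinearMap.adjoint.continuous.comp (tensorRight (H := H) (G := G)).continuous

/-- The rank-one-in-the-second-factor operator `id ⊗ (g ⊗ g)`. -/
def rankOneRight (g : G) : HilbertTensor H G →L[ℝ] HilbertTensor H G :=
  tensorRight g ∘L contractRight g

theorem inner_rankOneRight (g : G) (v : HilbertTensor H G) :
    inner ℝ v (rankOneRight g v) = ‖contractRight g v‖ ^ 2 := by
  rw [rankOneRight, ContinuousLinearMap.comp_apply, real_inner_comm, ← inner_contractRight,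
    real_inner_self_eq_norm_sq]

theorem norm_rankOneRight_le (g : G) : ‖rankOneRight (H := H) g‖ ≤ ‖g‖ ^ 2 := by
  rw [sq]
  exact (ContinuousLinearMap.opNorm_comp_le _ _).trans
    (mul_le_mul (norm_tensorRight_le g) (norm_contractRight_le g) (norm_nonneg _) (norm_nonneg _))

theorem continuous_rankOneRight :
    Continuous (rankOneRight : G → HilbertTensor H G →L[ℝ] HilbertTensor H G) :=
  (tensorRight (H := H) (G := G)).continuous.clm_comp continuous_contractRight

/-- Partial trace: the quadratic form `g ↦ ‖contractRight g v‖ ^ 2` is represented by a tensor. -/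
theorem exists_norm_contractRight_sq_eq (v : H ⊗[ℝ] G) :
    ∃ u : HilbertTensor G G, ‖u‖ ≤ ‖v‖ ^ 2 ∧
      ∀ g : G, ‖contractRight g (v : HilbertTensor H G)‖ ^ 2 = inner ℝ u (tensorRight g g) := by
  obtain ⟨d, e, g, he, rfl⟩ := exists_orthonormal_sum_tmul v
  have hcoe : ((∑ j, e j ⊗ₜ[ℝ] g j : H ⊗[ℝ] G) : HilbertTensor H G) =
      ∑ j, tensorRight (g j) (e j) :=
    map_sum (UniformSpace.Completion.toComplL (𝕜 := ℝ) (E := H ⊗[ℝ] G)) _ _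
  have hsq (a : Fin d → ℝ) : ‖∑ j, a j • e j‖ ^ 2 = ∑ j, a j ^ 2 := by
    rw [← real_inner_self_eq_norm_sq, he.inner_sum]
    simp [sq]
  -- For `v = ∑ e j ⊗ g j` with `e` orthonormal this is the trace of `v ⊗ v` over `H`. The triangle
  -- inequality bounds its norm by `∑ ‖g j‖ ^ 2 = ‖v‖ ^ 2`.
  refine ⟨∑ j, tensorRight (g j) (g j), ?_, fun k => ?_⟩
  · have : ‖(∑ j, e j ⊗ₜ[ℝ] g j : H ⊗[ℝ] G)‖ ^ 2 = ∑ j, ‖g j‖ ^ 2 := by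
      rw [← real_inner_self_eq_norm_sq, sum_inner]
      refine Finset.sum_congr rfl fun i _ => ?_
      rw [inner_sum]
      simp_rw [TensorProduct.inner_tmul, orthonormal_iff_ite.mp he]
      simp
    rw [this]
    refine (norm_sum_le _ _).trans (le_of_eq (Finset.sum_congr rfl fun j _ => ?_))
    rw [norm_tensorRight_apply, sq]
  · rw [hcoe, map_sum]
    simp_rw [contractRight_tensorRight]
    rw [hsq, sum_inner]
    refine Finset.sum_congr rfl fun j _ => ?_
    rw [inner_tensorRight, real_inner_comm, sq]

end Partial

/-! ### Features of the kernel and their measurability. -/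

section Kernel

variable {X : Type*} {H G : Type*} [NormedAddCommGroup H] [InnerProductSpace ℝ H]
  [CompleteSpace H] [NormedAddCommGroup G] [InnerProductSpace ℝ G] [CompleteSpace G]
  [RKHS ℝ G X ℝ]

/-- The canonical feature `k(x, ·)` of a point. -/
def feature (G : Type*) [NormedAddCommGroup G] [InnerProductSpace ℝ G] [CompleteSpace G]
    [RKHS ℝ G X ℝ] (x : X) : G :=
  RKHS.kerFun G x 1

theorem inner_feature (x : X) (g : G) : inner ℝ (feature G x) g = g x := by
  simp [feature]

theorem scalarKernel_eq_inner (x y : X) :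
    scalarKernel G x y = inner ℝ (feature G x) (feature G y) := by
  rw [inner_feature, feature, RKHS.kerFun_apply, scalarKernel]

theorem tensorEval_eq_contractRight (x : X) :
    (tensorEval x : HilbertTensor H G →L[ℝ] H) = contractRight (feature G x) := by
  ext v
  induction v using UniformSpace.Completion.induction_on with
  | hp => exact isClosed_eq (tensorEval x).continuous (contractRight _).continuous
  | ih v =>
    induction v using TensorProduct.induction_on with
    | zero => rw [UniformSpace.Completion.coe_zero, map_zero, map_zero]
    | tmul h g =>
      rw [tensorEval_tmul, ← tensorRight_apply, contractRight_tensorRight, inner_feature]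
    | add v w hv hw => rw [UniformSpace.Completion.coe_add, map_add, map_add, hv, hw]

/-- The measurable elements of `G` form a subspace, closed because norm convergence implies
pointwise convergence, and it contains the kernel sections, whose span is dense. -/
theorem measurable_coe [MeasurableSpace X]
    (hk : ∀ x, Measurable (scalarKernel G x : X → ℝ)) (g : G) : Measurable fun x : X => g x := by
  let S : Submodule ℝ G :=
    { carrier := {g | Measurable fun x : X => g x}
      add_mem' := fun {f g} hf hg => by
        change Measurable fun x : X => (f + g) x
        simp only [RKHS.coe_add, Pi.add_apply]
        exact Measurable.add hf hg
      zero_mem' := by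
        change Measurable fun x : X => (0 : G) x
        simp only [RKHS.coe_zero, Pi.zero_apply]
        exact measurable_const
      smul_mem' := fun c f hf => by
        change Measurable fun x : X => (c • f) x
        simp only [RKHS.coe_smul, Pi.smul_apply]
        exact Measurable.const_smul hf c }
  have hS : IsClosed (S : Set G) := by
    refine isClosed_of_closure_subset fun g hg => ?_
    obtain ⟨u, hu, hlim⟩ := mem_closure_iff_seq_limit.mp hg
    refine measurable_of_tendsto_metrizable (f := fun m x => u m x) hu ?_
    exact tendsto_pi_nhds.mpr fun x => ((RKHS.continuous_eval x).tendsto g).comp hlim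
  have hle : Submodule.span ℝ {RKHS.kerFun G x v | (x : X) (v : ℝ)} ≤ S := by
    rw [Submodule.span_le]
    rintro _ ⟨x, v, rfl⟩
    change Measurable fun y : X => RKHS.kerFun G x v y
    have : (fun y : X => RKHS.kerFun G x v y) = fun y => v * scalarKernel G x y := by
      funext y
      have h1 : RKHS.kerFun G x v = v • feature G x := by
        rw [feature, ← map_smul, smul_eq_mul, mul_one]
      rw [h1, RKHS.coe_smul, Pi.smul_apply, smul_eq_mul, ← inner_feature, scalarKernel_eq_inner,
        real_inner_comm]
    rw [this]
    exact (hk x).const_mul v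
  have htop := Submodule.topologicalClosure_minimal _ hle hS
  rw [RKHS.kerFun_dense] at htop
  exact htop trivial

/-- The coefficients of `k(x, ·)` in a Hilbert basis are the values `b i x`, measurable in `x`;
separability makes the basis countable, so the limit of the partial sums is strongly measurable. -/
theorem stronglyMeasurable_feature [MeasurableSpace X] [TopologicalSpace.SeparableSpace G]
    (hk : ∀ x, Measurable (scalarKernel G x : X → ℝ)) :
    StronglyMeasurable (feature G : X → G) := by
  obtain ⟨w, b, hb⟩ := exists_hilbertBasis ℝ G
  have hc : Countable w := b.orthonormal.countable_index
  refine stronglyMeasurable_of_tendsto Filter.atTop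
    (f := fun (s : Finset w) x => ∑ i ∈ s, (b i : G) x • b i) (fun s => ?_) ?_
  · exact Finset.stronglyMeasurable_fun_sum _ fun i _ =>
      (measurable_coe hk (b i)).stronglyMeasurable.smul_const _
  · refine tendsto_pi_nhds.mpr fun x => ?_
    have := b.hasSum_repr (feature G x)
    simp_rw [b.repr_apply_apply, real_inner_comm, inner_feature] at this
    exact this

theorem norm_feature_sq (x : X) : ‖feature G x‖ ^ 2 = scalarKernel G x x := by
  rw [scalarKernel_eq_inner, real_inner_self_eq_norm_sq]

end Kernel

section

variable {X : Type*} {H G : Type*} [NormedAddCommGroup H] [InnerProductSpace ℝ H]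
  [CompleteSpace H] [NormedAddCommGroup G] [InnerProductSpace ℝ G] [CompleteSpace G]
  [RKHS ℝ G X ℝ]

/-! ### Population versus empirical second moments. -/

section Covariance

theorem norm_tensorEval_apply_le {κ : ℝ} (hκ : ∀ x : X, ‖feature G x‖ ≤ κ) (x : X)
    (v : HilbertTensor H G) : ‖tensorEval x v‖ ≤ κ * ‖v‖ := by
  rw [tensorEval_eq_contractRight]
  exact (norm_contractRight_apply_le _ v).trans
    (mul_le_mul_of_nonneg_right (hκ x) (norm_nonneg v))

variable [MeasurableSpace X]

theorem stronglyMeasurable_tensorEval (hf : StronglyMeasurable (feature G : X → G))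
    (v : HilbertTensor H G) : StronglyMeasurable fun x : X => tensorEval x v := by
  simp_rw [tensorEval_eq_contractRight]
  exact (continuous_contractRight.clm_apply continuous_const).comp_stronglyMeasurable hf

variable (H) in
/-- The covariance operator `∫ id ⊗ (k(x, ·) ⊗ k(x, ·)) dρ(x)` on the Hilbert tensor product. -/
def covariance (G : Type*) [NormedAddCommGroup G] [InnerProductSpace ℝ G] [CompleteSpace G]
    [RKHS ℝ G X ℝ] (ρ : Measure X) : HilbertTensor H G →L[ℝ] HilbertTensor H G :=
  ∫ x, rankOneRight (feature G x) ∂ρ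

variable (G) in
/-- The mean of the tensor `k(x, ·) ⊗ k(x, ·)`. -/
def meanTensor (ρ : Measure X) : HilbertTensor G G :=
  ∫ x, tensorRight (feature G x) (feature G x) ∂ρ

variable {ρ : Measure X} [IsProbabilityMeasure ρ]

theorem stronglyMeasurable_tensorRight_feature (hf : StronglyMeasurable (feature G : X → G)) :
    StronglyMeasurable fun x : X => tensorRight (feature G x) (feature G x) :=
  ((tensorRight (H := G) (G := G)).continuous.clm_apply
    continuous_id).comp_stronglyMeasurable hf

omit [MeasurableSpace X] in
theorem norm_tensorRight_feature_le {κ : ℝ} (hκ : ∀ x : X, ‖feature G x‖ ≤ κ) (x : X) :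
    ‖tensorRight (feature G x) (feature G x)‖ ≤ κ ^ 2 := by
  rw [norm_tensorRight_apply, sq]
  have := hκ x
  gcongr
  exact (norm_nonneg _).trans this

theorem integrable_tensorRight_feature (hf : StronglyMeasurable (feature G : X → G)) {κ : ℝ}
    (hκ : ∀ x : X, ‖feature G x‖ ≤ κ) :
    Integrable (fun x : X => tensorRight (feature G x) (feature G x)) ρ :=
  .of_bound (stronglyMeasurable_tensorRight_feature hf).aestronglyMeasurable (κ ^ 2)
    (.of_forall (norm_tensorRight_feature_le hκ))

omit [RKHS ℝ G X ℝ] in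
theorem inner_integral_clm_apply {A : X → G →L[ℝ] G} (hA : StronglyMeasurable A) {C : ℝ}
    (hC : ∀ x, ‖A x‖ ≤ C) (v : G) :
    inner ℝ v ((∫ x, A x ∂ρ) v) = ∫ x, inner ℝ v (A x v) ∂ρ := by
  have hint : Integrable A ρ := .of_bound hA.aestronglyMeasurable C (.of_forall hC)
  rw [ContinuousLinearMap.integral_apply hint,
    ← integral_inner (hint.apply_continuousLinearMap v)]

theorem inner_covariance (hf : StronglyMeasurable (feature G : X → G)) {κ : ℝ}
    (hκ : ∀ x : X, ‖feature G x‖ ≤ κ) (v : HilbertTensor H G) :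
    inner ℝ v (covariance H G ρ v) = ∫ x, ‖tensorEval x v‖ ^ 2 ∂ρ := by
  have h := inner_integral_clm_apply (ρ := ρ) (C := κ ^ 2)
    (continuous_rankOneRight.comp_stronglyMeasurable hf)
    (fun x => (norm_rankOneRight_le (H := H) (feature G x)).trans (by have := hκ x; gcongr)) v
  rw [covariance, h]
  simp_rw [inner_rankOneRight, tensorEval_eq_contractRight]

/-- The population and the empirical second moments differ by at most the distance between the
population and the empirical mean tensors. -/
theorem integral_norm_tensorEval_sq_le (hf : StronglyMeasurable (feature G : X → G)) {κ : ℝ}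
    (hκ : ∀ x : X, ‖feature G x‖ ≤ κ) {n : ℕ} (hn : 1 ≤ n) (xs : Fin n → X)
    (v : HilbertTensor H G) :
    ∫ x, ‖tensorEval x v‖ ^ 2 ∂ρ ≤ (n : ℝ)⁻¹ * ∑ i, ‖tensorEval (xs i) v‖ ^ 2 +
      (n : ℝ)⁻¹ * ‖∑ i, (tensorRight (feature G (xs i)) (feature G (xs i)) - meanTensor G ρ)‖
        * ‖v‖ ^ 2 := by
  have hn' : (n : ℝ) ≠ 0 := by positivity
  rw [← inner_covariance hf hκ]
  simp_rw [tensorEval_eq_contractRight, ← inner_rankOneRight, ← inner_sum,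
    ← _root_.sum_apply]
  -- The partial trace is available for algebraic tensors only; both sides are continuous in `v`, so
  -- density suffices.
  induction v using UniformSpace.Completion.induction_on with
  | hp => exact isClosed_le (by fun_prop) (by fun_prop)
  | ih v =>
    rw [inner_covariance hf hκ]
    simp_rw [_root_.sum_apply, inner_sum, inner_rankOneRight,
      tensorEval_eq_contractRight]
    obtain ⟨u, hu, huv⟩ := exists_norm_contractRight_sq_eq v
    simp_rw [huv]
    rw [integral_inner (integrable_tensorRight_feature hf hκ), ← meanTensor, ← inner_sum]
    have h1 : inner ℝ u (meanTensor G ρ) -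
        (n : ℝ)⁻¹ * inner ℝ u (∑ i, tensorRight (feature G (xs i)) (feature G (xs i))) =
        (n : ℝ)⁻¹ * inner ℝ u
          (-∑ i, (tensorRight (feature G (xs i)) (feature G (xs i)) - meanTensor G ρ)) := by
      rw [Finset.sum_sub_distrib, inner_neg_right, inner_sub_right]
      simp only [Finset.sum_const, Finset.card_univ, Fintype.card_fin, ← Nat.cast_smul_eq_nsmul ℝ,
        inner_smul_right]
      field_simp
      ring
    have h2 : inner ℝ u
        (-∑ i, (tensorRight (feature G (xs i)) (feature G (xs i)) - meanTensor G ρ)) ≤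
        ‖∑ i, (tensorRight (feature G (xs i)) (feature G (xs i)) - meanTensor G ρ)‖ *
          ‖v‖ ^ 2 := by
      refine (real_inner_le_norm _ _).trans ?_
      rw [norm_neg, mul_comm]
      gcongr
    rw [UniformSpace.Completion.norm_coe, mul_assoc]
    have h3 := mul_le_mul_of_nonneg_left h2 (inv_nonneg.mpr (Nat.cast_nonneg (α := ℝ) n))
    linarith

end Covariance

/-! ### Kernel ridge regression: normal equation and deterministic bounds. -/

section KernelRidge

/-- The kernel ridge regression estimator as an element of the Hilbert tensor product. -/
def krrTensor {n : ℕ} (xs : Fin n → X) (ys : Fin n → H) (reg : ℝ) : HilbertTensor H G :=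
  ∑ j, tensorRight (feature G (xs j)) (∑ i,
    ((Matrix.of fun i j => scalarKernel G (xs i) (xs j)) +
      ((n : ℝ) * reg) • (1 : Matrix (Fin n) (Fin n) ℝ))⁻¹ i j • ys i)

theorem tensorEval_krrTensor {n : ℕ} (xs : Fin n → X) (ys : Fin n → H) (reg : ℝ) (x : X) :
    tensorEval x (krrTensor (G := G) xs ys reg) =
      ∑ i, krrWeights (scalarKernel G) xs reg x i • ys i := by
  rw [tensorEval_eq_contractRight, krrTensor, map_sum]
  simp_rw [contractRight_tensorRight, ← scalarKernel_eq_inner, krrWeights, Matrix.mulVec,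
    dotProduct, Finset.sum_smul, Finset.smul_sum, smul_smul]
  rw [Finset.sum_comm]
  simp_rw [mul_comm]

/-- Both sides are combinations of the `k(x_l, ·)`, so it is enough to match the coefficients in
`H`, which amounts to `A⁻¹ * A = 1`; `A` is invertible as a Gram matrix plus a positive multiple of
the identity. -/
theorem krrTensor_normal_equation {n : ℕ} (hn : 1 ≤ n) (xs : Fin n → X) (ys : Fin n → H)
    {reg : ℝ} (hreg : 0 < reg) :
    ∑ l, tensorRight (feature G (xs l)) (tensorEval (xs l) (krrTensor (G := G) xs ys reg)) +
      ((n : ℝ) * reg) • krrTensor (G := G) xs ys reg =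
    ∑ l, tensorRight (feature G (xs l)) (ys l) := by
  have hn' : (0 : ℝ) < n := by exact_mod_cast hn
  set A : Matrix (Fin n) (Fin n) ℝ := (Matrix.of fun i j => scalarKernel G (xs i) (xs j)) +
      ((n : ℝ) * reg) • (1 : Matrix (Fin n) (Fin n) ℝ) with hA
  have hgram : (Matrix.of fun i j => scalarKernel G (xs i) (xs j)) =
      Matrix.gram ℝ fun i => feature G (xs i) := by
    ext i j
    rw [Matrix.of_apply, Matrix.gram_apply, scalarKernel_eq_inner]
  have hpos : A.PosDef := by
    rw [hA, hgram]
    have hone : (((n : ℝ) * reg) • (1 : Matrix (Fin n) (Fin n) ℝ)).PosDef :=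
      Matrix.PosDef.one.smul (by positivity)
    exact hone.posSemidef_add (Matrix.posSemidef_gram ℝ _)
  have hinv : A⁻¹ * A = 1 := Matrix.nonsing_inv_mul _ ((Matrix.isUnit_iff_isUnit_det _).mp hpos.isUnit)
  have hev (l : Fin n) : tensorEval (xs l) (krrTensor (G := G) xs ys reg) =
      ∑ j, scalarKernel G (xs l) (xs j) • ∑ i, A⁻¹ i j • ys i := by
    rw [tensorEval_eq_contractRight, krrTensor, map_sum]
    simp_rw [contractRight_tensorRight, ← scalarKernel_eq_inner]
    rfl
  rw [krrTensor, Finset.smul_sum, ← Finset.sum_add_distrib]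
  refine Finset.sum_congr rfl fun l _ => ?_
  rw [← krrTensor, hev, ← map_smul, ← map_add]
  congr 1
  have h1 : ∑ j, scalarKernel G (xs l) (xs j) • ∑ i, A⁻¹ i j • ys i +
      ((n : ℝ) * reg) • ∑ i, A⁻¹ i l • ys i = ∑ j, A j l • ∑ i, A⁻¹ i j • ys i := by
    simp only [hA, Matrix.add_apply, Matrix.of_apply, Matrix.smul_apply, Matrix.one_apply,
      add_smul, Finset.sum_add_distrib, smul_eq_mul, mul_ite, mul_one, mul_zero, ite_smul,
      zero_smul, Finset.sum_ite_eq', Finset.mem_univ, if_true]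
    congr 1
    refine Finset.sum_congr rfl fun j _ => ?_
    rw [scalarKernel_eq_inner, scalarKernel_eq_inner, real_inner_comm]
  rw [h1]
  simp_rw [Finset.smul_sum, smul_smul]
  rw [Finset.sum_comm]
  have h2 (i : Fin n) : ∑ j, (A j l * A⁻¹ i j) • ys i = (1 : Matrix (Fin n) (Fin n) ℝ) i l • ys i := by
    rw [← Finset.sum_smul, ← hinv, Matrix.mul_apply]
    simp_rw [mul_comm]
  simp_rw [h2, Matrix.one_apply, ite_smul, one_smul, zero_smul]
  simp

/-- Deterministic error bound for kernel ridge regression: the empirical noise `ε` controls the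
estimator in the norm of the Hilbert tensor product and in the empirical `L²` norm. -/
theorem krrTensor_sub_bounds {n : ℕ} (hn : 1 ≤ n) (xs : Fin n → X) (ys : Fin n → H)
    {reg : ℝ} (hreg : 0 < reg) (w : HilbertTensor H G) {a R : ℝ} (hw : ‖w‖ ≤ R)
    (ha : ‖∑ l, tensorRight (feature G (xs l)) (ys l - tensorEval (xs l) w)‖ ≤ n * reg * a) :
    ‖krrTensor xs ys reg - w‖ ≤ a + R ∧
      (n : ℝ)⁻¹ * ∑ l, ‖tensorEval (xs l) (krrTensor xs ys reg - w)‖ ^ 2 ≤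
        reg * (a + R) ^ 2 := by
  have hn' : (0 : ℝ) < n := by exact_mod_cast hn
  set v := krrTensor xs ys reg - w with hv
  set ε := ∑ l, tensorRight (feature G (xs l)) (ys l - tensorEval (xs l) w) with hε
  have heq : ∑ l, tensorRight (feature G (xs l)) (tensorEval (xs l) v) + ((n : ℝ) * reg) • v =
      ε - ((n : ℝ) * reg) • w := by
    have := krrTensor_normal_equation (G := G) hn xs ys hreg
    rw [hv, hε, smul_sub]
    simp_rw [map_sub, Finset.sum_sub_distrib]
    rw [← this]
    abel
  -- Energy identity: the equation for the error is paired with `v` itself, and the two nonnegative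
  -- terms give the two bounds.
  have hin : ∑ l, ‖tensorEval (xs l) v‖ ^ 2 + n * reg * ‖v‖ ^ 2 =
      inner ℝ v (ε - ((n : ℝ) * reg) • w) := by
    rw [← heq, inner_add_right, inner_smul_right, real_inner_self_eq_norm_sq, inner_sum]
    congr 1
    refine Finset.sum_congr rfl fun l _ => ?_
    rw [tensorEval_eq_contractRight, ← inner_rankOneRight]
    rfl
  have hnr : 0 < n * reg := by positivity
  have hle : inner ℝ v (ε - ((n : ℝ) * reg) • w) ≤ ‖v‖ * (n * reg * (a + R)) := by
    refine (real_inner_le_norm _ _).trans (mul_le_mul_of_nonneg_left ?_ (norm_nonneg _))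
    refine (norm_sub_le _ _).trans ?_
    rw [norm_smul, Real.norm_of_nonneg hnr.le, mul_add]
    gcongr
  have hsum : 0 ≤ ∑ l, ‖tensorEval (xs l) v‖ ^ 2 := Finset.sum_nonneg fun _ _ => sq_nonneg _
  have haR : 0 ≤ a + R := by
    have h1 : 0 ≤ n * reg * a := (norm_nonneg _).trans ha
    have h2 : 0 ≤ a := nonneg_of_mul_nonneg_right h1 hnr
    linarith [(norm_nonneg w).trans hw]
  have hnorm : ‖v‖ ≤ a + R := by
    by_contra! h
    have h0 : 0 < ‖v‖ := haR.trans_lt h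
    have : ‖v‖ * (n * reg * (a + R)) < n * reg * ‖v‖ ^ 2 := by
      rw [sq, show ‖v‖ * (n * reg * (a + R)) = n * reg * ‖v‖ * (a + R) by ring,
        show n * reg * (‖v‖ * ‖v‖) = n * reg * ‖v‖ * ‖v‖ by ring]
      exact mul_lt_mul_of_pos_left h (by positivity)
    linarith
  refine ⟨hnorm, ?_⟩
  rw [inv_mul_le_iff₀ hn']
  have h1 : ‖v‖ * (n * reg * (a + R)) ≤ (a + R) * (n * reg * (a + R)) := by gcongr
  have h2 : 0 ≤ n * reg * ‖v‖ ^ 2 := by positivity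
  nlinarith

end KernelRidge

end

section

variable {X : Type*} {H G : Type*} [NormedAddCommGroup H] [InnerProductSpace ℝ H]
  [CompleteSpace H] [NormedAddCommGroup G] [InnerProductSpace ℝ G] [CompleteSpace G]
  [RKHS ℝ G X ℝ]

theorem stronglyMeasurable_bilinear {α E F K : Type*} [MeasurableSpace α] [NormedAddCommGroup E]
    [NormedSpace ℝ E] [NormedAddCommGroup F] [NormedSpace ℝ F] [NormedAddCommGroup K]
    [NormedSpace ℝ K] (L : E →L[ℝ] F →L[ℝ] K) {f : α → E} {g : α → F}
    (hf : StronglyMeasurable f) (hg : StronglyMeasurable g) :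
    StronglyMeasurable fun z => L (f z) (g z) :=
  L.continuous₂.comp_stronglyMeasurable (hf.prodMk hg)

/-! ### High-probability error of a single regression. -/

section SingleTask

variable [MeasurableSpace X] {Y : Type*} [MeasurableSpace Y] {ρX : Measure X}
  [IsProbabilityMeasure ρX] {η : Kernel X Y} [IsMarkovKernel η]

/-- The noise vector `k(x, ·) ⊗ (ψ(y) - w(x))`. -/
def noiseTensor (ψ : Y → H) (w : HilbertTensor H G) (z : X × Y) : HilbertTensor H G :=
  tensorRight (feature G z.1) (ψ z.2 - tensorEval z.1 w)

theorem stronglyMeasurable_noiseTensor (hf : StronglyMeasurable (feature G : X → G)) {ψ : Y → H}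
    (hψ : StronglyMeasurable ψ) (w : HilbertTensor H G) :
    StronglyMeasurable (noiseTensor ψ w : X × Y → HilbertTensor H G) := by
  exact stronglyMeasurable_bilinear tensorRight (hf.comp_measurable measurable_fst)
    ((hψ.comp_measurable measurable_snd).sub
      ((stronglyMeasurable_tensorEval hf w).comp_measurable measurable_fst))

omit [MeasurableSpace X] [MeasurableSpace Y] in
theorem norm_noiseTensor_le {κ : ℝ} (hκ : ∀ x : X, ‖feature G x‖ ≤ κ) (hκ0 : 0 ≤ κ) {ψ : Y → H}
    {B : ℝ} (hB : ∀ y, ‖ψ y‖ ≤ B) {w : HilbertTensor H G} {R : ℝ} (hw : ‖w‖ ≤ R) (z : X × Y) :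
    ‖noiseTensor ψ w z‖ ≤ (B + κ * R) * κ := by
  rw [noiseTensor, norm_tensorRight_apply]
  have h1 : ‖ψ z.2 - tensorEval z.1 w‖ ≤ B + κ * R :=
    (norm_sub_le _ _).trans (add_le_add (hB _)
      ((norm_tensorEval_apply_le hκ _ _).trans (mul_le_mul_of_nonneg_left hw hκ0)))
  exact mul_le_mul h1 (hκ _) (norm_nonneg _) ((norm_nonneg _).trans h1)

/-- Conditionally on `x`, the factor `ψ y - w x` is centred and `k(x, ·)` is fixed. -/
theorem integral_noiseTensor (hf : StronglyMeasurable (feature G : X → G)) {κ : ℝ}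
    (hκ : ∀ x : X, ‖feature G x‖ ≤ κ) (hκ0 : 0 ≤ κ) {ψ : Y → H} (hψ : StronglyMeasurable ψ)
    {B : ℝ} (hB : ∀ y, ‖ψ y‖ ≤ B) (w : HilbertTensor H G)
    (hreg : ∀ᵐ x ∂ρX, ∫ y, ψ y ∂(η x) = tensorEval x w) :
    ∫ z, noiseTensor ψ w z ∂(ρX ⊗ₘ η) = 0 := by
  have hint : Integrable (noiseTensor ψ w : X × Y → HilbertTensor H G) (ρX ⊗ₘ η) :=
    .of_bound (stronglyMeasurable_noiseTensor hf hψ w).aestronglyMeasurable _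
      (.of_forall (norm_noiseTensor_le hκ hκ0 hB le_rfl))
  rw [Measure.integral_compProd hint]
  refine integral_eq_zero_of_ae ?_
  filter_upwards [hreg] with x hx
  have hψint : Integrable ψ (η x) := .of_bound hψ.aestronglyMeasurable B (.of_forall hB)
  have h0 : ∫ y, (ψ y - tensorEval x w) ∂(η x) = 0 := by
    rw [integral_sub hψint (integrable_const _), hx]
    simp
  have h1 := ContinuousLinearMap.integral_comp_comm (tensorRight (H := H) (feature G x))
    (φ := fun y => ψ y - tensorEval x w) (hψint.sub (integrable_const _))
  rw [h0, map_zero] at h1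
  exact h1

theorem integral_fst_compProd {E : Type*} [NormedAddCommGroup E] [NormedSpace ℝ E] {g : X → E}
    (hg : StronglyMeasurable g) : ∫ z, g z.1 ∂(ρX ⊗ₘ η) = ∫ x, g x ∂ρX := by
  conv_rhs => rw [← Measure.fst_compProd ρX η, Measure.fst]
  rw [integral_map measurable_fst.aemeasurable hg.aestronglyMeasurable]

/-- High-probability `L²` error bound for vector-valued kernel ridge regression. -/
theorem exists_krr_error_bound (hf : StronglyMeasurable (feature G : X → G)) {κ : ℝ}
    (hκ : ∀ x : X, ‖feature G x‖ ≤ κ) (hκ0 : 0 < κ) {ψ : Y → H} (hψ : StronglyMeasurable ψ)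
    {B : ℝ} (hB0 : 0 < B) (hB : ∀ y, ‖ψ y‖ ≤ B) {w : HilbertTensor H G} {R : ℝ} (hw : ‖w‖ ≤ R)
    (hreg : ∀ᵐ x ∂ρX, ∫ y, ψ y ∂(η x) = tensorEval x w)
    {n : ℕ} (hn : 1 ≤ n) {Ω : Type*} [MeasurableSpace Ω] {P : Measure Ω} [IsProbabilityMeasure P]
    {Z : Fin n → Ω → X × Y} (hZ : ∀ i, Measurable (Z i)) (hlaw : ∀ i, P.map (Z i) = ρX ⊗ₘ η)
    (hind : iIndepFun Z P) {τ : ℝ} (hτ : 1 ≤ τ) :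
    ∃ A : Set Ω, MeasurableSet A ∧ P.real Aᶜ ≤ 4 * Real.exp (-τ) ∧ ∀ ω ∈ A,
      ∫ x, ‖tensorEval x (krrTensor (fun i => (Z i ω).1) (fun i => ψ (Z i ω).2)
        ((n : ℝ) ^ (-(1 / 2) : ℝ)) - w)‖ ^ 2 ∂ρX ≤
        (2 * ((B + κ * R) * κ) + R) ^ 2 * (1 + 4 * κ ^ 2) * τ ^ 2 * (n : ℝ) ^ (-(1 / 2) : ℝ) := by
  have hn' : (0 : ℝ) < n := by exact_mod_cast hn
  have hR : 0 ≤ R := (norm_nonneg w).trans hw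
  set M : ℝ := (B + κ * R) * κ with hM
  have hM0 : 0 < M := by positivity
  set r : ℝ := (n : ℝ) ^ (-(1 / 2) : ℝ) with hr
  have hr0 : 0 < r := Real.rpow_pos_of_pos hn' _
  -- The choice `λ = n ^ (-1/2)` makes `n * λ` equal to the order `√n` of the fluctuations, so the
  -- noise divided by `n * λ` is bounded by `2 * M * √τ`, free of `n`.
  have hsqrt : √(n : ℝ) = n * r := by
    rw [hr, Real.sqrt_eq_rpow]
    conv_rhs => rw [← Real.rpow_one (n : ℝ), ← Real.rpow_mul hn'.le, ← Real.rpow_add hn']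
    norm_num
  have hsqrt' : √(n * τ) = n * r * √τ := by rw [Real.sqrt_mul hn'.le, hsqrt]
  let φ : X × Y → HilbertTensor G G := fun z =>
    tensorRight (feature G z.1) (feature G z.1) - meanTensor G ρX
  have hTm := stronglyMeasurable_tensorRight_feature hf
  have hφm : StronglyMeasurable φ :=
    (hTm.comp_measurable measurable_fst).sub stronglyMeasurable_const
  have hmean : ‖meanTensor G ρX‖ ≤ κ ^ 2 := by
    refine (norm_integral_le_of_norm_le_const
      (.of_forall (norm_tensorRight_feature_le hκ))).trans ?_
    simp
  have hφb (z : X × Y) : ‖φ z‖ ≤ 2 * κ ^ 2 := by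
    refine (norm_sub_le _ _).trans ?_
    linarith [norm_tensorRight_feature_le (G := G) hκ z.1]
  have hφ0 : ∫ z, φ z ∂(ρX ⊗ₘ η) = 0 := by
    rw [integral_fst_compProd (g := fun x =>
      tensorRight (feature G x) (feature G x) - meanTensor G ρX)
      (hTm.sub stronglyMeasurable_const),
      integral_sub (integrable_tensorRight_feature hf hκ) (integrable_const _), ← meanTensor]
    simp
  have hξm := stronglyMeasurable_noiseTensor (G := G) hf hψ w
  have t1 := measureReal_norm_sum_gt_le hn hZ hlaw hind hξm hM0
    (norm_noiseTensor_le hκ hκ0.le hB hw) (integral_noiseTensor hf hκ hκ0.le hψ hB w hreg)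
    (zero_le_one.trans hτ)
  have t2 := measureReal_norm_sum_gt_le hn hZ hlaw hind hφm (M := 2 * κ ^ 2) (by positivity)
    hφb hφ0 (zero_le_one.trans hτ)
  have m1 : MeasurableSet {ω | 2 * M * √(n * τ) < ‖∑ i, noiseTensor ψ w (Z i ω)‖} :=
    measurableSet_lt measurable_const (Finset.stronglyMeasurable_fun_sum _ fun i _ =>
      hξm.comp_measurable (hZ i)).norm.measurable
  have m2 : MeasurableSet {ω | 2 * (2 * κ ^ 2) * √(n * τ) < ‖∑ i, φ (Z i ω)‖} :=
    measurableSet_lt measurable_const (Finset.stronglyMeasurable_fun_sum _ fun i _ =>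
      hφm.comp_measurable (hZ i)).norm.measurable
  refine ⟨_, (m1.union m2).compl, ?_, fun ω hω => ?_⟩
  · rw [compl_compl]
    refine (measureReal_union_le _ _).trans ?_
    linarith
  rw [Set.compl_union, Set.mem_inter_iff, Set.mem_compl_iff, Set.mem_compl_iff,
    Set.mem_ofPred_eq, Set.mem_ofPred_eq, not_lt, not_lt, hsqrt'] at hω
  obtain ⟨h1, h2⟩ := hω
  obtain ⟨hv, hemp⟩ := krrTensor_sub_bounds hn (fun i => (Z i ω).1) (fun i => ψ (Z i ω).2) hr0 w
    (a := 2 * M * √τ) hw (h1.trans (le_of_eq (by ring)))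
  have hpop := integral_norm_tensorEval_sq_le (ρ := ρX) hf hκ hn (fun i => (Z i ω).1)
    (krrTensor (fun i => (Z i ω).1) (fun i => ψ (Z i ω).2) r - w)
  have h3 : (n : ℝ)⁻¹ * ‖∑ i, φ (Z i ω)‖ ≤ 4 * κ ^ 2 * r * √τ := by
    rw [inv_mul_le_iff₀ hn']
    exact h2.trans (le_of_eq (by ring))
  set v := krrTensor (fun i => (Z i ω).1) (fun i => ψ (Z i ω).2) r - w with hvdef
  have hs1 : 1 ≤ √τ := Real.one_le_sqrt.mpr hτ
  have hs2 : √τ * √τ = τ := Real.mul_self_sqrt (zero_le_one.trans hτ)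
  have h4 : 2 * M * √τ + R ≤ (2 * M + R) * √τ := by
    have := le_mul_of_one_le_right hR hs1
    linarith
  have h5 : (2 * M * √τ + R) ^ 2 ≤ (2 * M + R) ^ 2 * τ := by
    refine (pow_le_pow_left₀ (by positivity) h4 2).trans (le_of_eq ?_)
    rw [mul_pow, sq √τ, hs2]
  have h6 : 1 + 4 * κ ^ 2 * √τ ≤ (1 + 4 * κ ^ 2) * τ := by
    have h8 : √τ ≤ τ := by
      conv_rhs => rw [← hs2]
      exact le_mul_of_one_le_left (zero_le_one.trans hs1) hs1
    have h9 := mul_le_mul_of_nonneg_left h8 (show 0 ≤ 4 * κ ^ 2 by positivity)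
    linarith
  have h7 : (n : ℝ)⁻¹ * ‖∑ i, φ (Z i ω)‖ * ‖v‖ ^ 2 ≤
      4 * κ ^ 2 * r * √τ * (2 * M * √τ + R) ^ 2 := by
    gcongr
  calc _ ≤ _ := hpop
    _ ≤ r * (2 * M * √τ + R) ^ 2 + 4 * κ ^ 2 * r * √τ * (2 * M * √τ + R) ^ 2 :=
      add_le_add hemp h7
    _ = r * ((2 * M * √τ + R) ^ 2 * (1 + 4 * κ ^ 2 * √τ)) := by ring
    _ ≤ r * (((2 * M + R) ^ 2 * τ) * ((1 + 4 * κ ^ 2) * τ)) := by gcongr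
    _ = _ := by ring

end SingleTask

end

/-! ### Pointwise comparison of the true and surrogate objectives. -/

section Comparison

variable {Y : Type*} {H : Type*} [NormedAddCommGroup H] [InnerProductSpace ℝ H] [CompleteSpace H]
  {T : ℕ}

omit [CompleteSpace H] in
theorem abs_mean_inner_le (a d : Fin T → H) :
    |(T : ℝ)⁻¹ * ∑ t, inner ℝ (a t) (d t)| ≤
      √((T : ℝ)⁻¹ * ∑ t, ‖a t‖ ^ 2) * √((T : ℝ)⁻¹ * ∑ t, ‖d t‖ ^ 2) := by
  have hT : (0 : ℝ) ≤ (T : ℝ)⁻¹ := by positivity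
  rw [abs_mul, abs_of_nonneg hT, Real.sqrt_mul hT, Real.sqrt_mul hT]
  calc (T : ℝ)⁻¹ * |∑ t, inner ℝ (a t) (d t)|
      ≤ (T : ℝ)⁻¹ * (√(∑ t, ‖a t‖ ^ 2) * √(∑ t, ‖d t‖ ^ 2)) := by
        gcongr
        refine (Finset.abs_sum_le_sum_abs _ _).trans
          ((Finset.sum_le_sum fun t _ => abs_real_inner_le_norm (a t) (d t)).trans ?_)
        exact Real.sum_mul_le_sqrt_mul_sqrt _ _ _
    _ = (√(T : ℝ)⁻¹ * √(T : ℝ)⁻¹) * (√(∑ t, ‖a t‖ ^ 2) * √(∑ t, ‖d t‖ ^ 2)) := by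
        rw [Real.mul_self_sqrt hT]
    _ = _ := by ring

theorem qConst_nonneg (ψ : Y → H) (V : H →L[ℝ] H) (C : Set (Fin T → Y)) : 0 ≤ qConst ψ V C :=
  mul_nonneg zero_le_two (Real.iSup_nonneg fun _ => Real.sqrt_nonneg _)

theorem sqrt_mean_le_qConst {ψ : Y → H} {B : ℝ} (hB : ∀ y, ‖ψ y‖ ≤ B) (V : H →L[ℝ] H)
    {C : Set (Fin T → Y)} {c : Fin T → Y} (hc : c ∈ C) :
    √((T : ℝ)⁻¹ * ∑ t, ‖ContinuousLinearMap.adjoint V (ψ (c t))‖ ^ 2) ≤ qConst ψ V C / 2 := by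
  -- Without boundedness the real supremum would take its default value 0.
  have hbdd : BddAbove (Set.range fun c : C =>
      √((T : ℝ)⁻¹ * ∑ t, ‖ContinuousLinearMap.adjoint V (ψ (c.1 t))‖ ^ 2)) := by
    refine ⟨√((T : ℝ)⁻¹ * ∑ _t : Fin T, (‖ContinuousLinearMap.adjoint V‖ * B) ^ 2), ?_⟩
    rintro _ ⟨c, rfl⟩
    refine Real.sqrt_le_sqrt ?_
    gcongr with t
    exact (ContinuousLinearMap.le_opNorm _ _).trans
      (mul_le_mul_of_nonneg_left (hB _) (norm_nonneg _))
  have := le_ciSup hbdd ⟨c, hc⟩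
  rw [qConst]
  linarith

/-- Comparison inequality at a point: if `c` does at least as well as `c'` for the surrogates `u t`,
then its excess risk for the targets `g t` is controlled by the distance of `u` and `g`. -/
theorem mean_inner_sub_le {ψ : Y → H} {B : ℝ} (hB : ∀ y, ‖ψ y‖ ≤ B) (V : H →L[ℝ] H)
    {C : Set (Fin T → Y)} {c c' : Fin T → Y} (hc : c ∈ C) (hc' : c' ∈ C) (u g : Fin T → H)
    (hmin : ∑ t, inner ℝ (ψ (c t)) (V (u t)) ≤ ∑ t, inner ℝ (ψ (c' t)) (V (u t))) :
    (T : ℝ)⁻¹ * ∑ t, inner ℝ (ψ (c t)) (V (g t)) - (T : ℝ)⁻¹ * ∑ t, inner ℝ (ψ (c' t)) (V (g t)) ≤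
      qConst ψ V C * √((T : ℝ)⁻¹ * ∑ t, ‖u t - g t‖ ^ 2) := by
  have key {c : Fin T → Y} (hc : c ∈ C) :
      |(T : ℝ)⁻¹ * ∑ t, inner ℝ (ψ (c t)) (V (u t)) - (T : ℝ)⁻¹ * ∑ t, inner ℝ (ψ (c t)) (V (g t))| ≤
        qConst ψ V C / 2 * √((T : ℝ)⁻¹ * ∑ t, ‖u t - g t‖ ^ 2) := by
    rw [← mul_sub, ← Finset.sum_sub_distrib]
    simp_rw [← inner_sub_right, ← map_sub, ← ContinuousLinearMap.adjoint_inner_left]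
    exact (abs_mean_inner_le _ _).trans
      (mul_le_mul_of_nonneg_right (sqrt_mean_le_qConst hB V hc) (Real.sqrt_nonneg _))
  have h1 := abs_le.mp (key hc)
  have h2 := abs_le.mp (key hc')
  have h3 := mul_le_mul_of_nonneg_left hmin (show (0 : ℝ) ≤ (T : ℝ)⁻¹ by positivity)
  linarith [h1.1, h2.2]

end Comparison

/-! ### From regression error to excess risk. -/

section Risk

variable {X Y : Type*} [MeasurableSpace X] [MeasurableSpace Y] {H G : Type*}
  [NormedAddCommGroup H] [InnerProductSpace ℝ H] [CompleteSpace H]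
  [NormedAddCommGroup G] [InnerProductSpace ℝ G] [CompleteSpace G] [RKHS ℝ G X ℝ] {T : ℕ}
  {ρX : Measure X} [IsProbabilityMeasure ρX] {η : Fin T → Kernel X Y} [∀ t, IsMarkovKernel (η t)]

theorem integrable_inner_tensorEval (hf : StronglyMeasurable (feature G : X → G)) {κ : ℝ}
    (hκ : ∀ x : X, ‖feature G x‖ ≤ κ) {ψ : Y → H} (hψ : StronglyMeasurable ψ) {B : ℝ}
    (hB : ∀ y, ‖ψ y‖ ≤ B) (V : H →L[ℝ] H) (w : HilbertTensor H G) {f : X → Y}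
    (hfm : Measurable f) : Integrable (fun x => inner ℝ (ψ (f x)) (V (tensorEval x w))) ρX := by
  refine .of_bound (C := B * (‖V‖ * (κ * ‖w‖))) ?_ (.of_forall fun x => ?_)
  · exact ((hψ.comp_measurable hfm).inner
      (V.continuous.comp_stronglyMeasurable (stronglyMeasurable_tensorEval hf w))).aestronglyMeasurable
  · refine (norm_inner_le_norm _ _).trans (mul_le_mul (hB _) ?_ (norm_nonneg _)
      ((norm_nonneg _).trans (hB (f x))))
    exact (V.le_opNorm _).trans
      (mul_le_mul_of_nonneg_left (norm_tensorEval_apply_le hκ x w) (norm_nonneg _))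

omit [CompleteSpace G] in
theorem integral_loss_eq {ℓ : Y → Y → ℝ} {ψ : Y → H} (hψ : StronglyMeasurable ψ) {B : ℝ}
    (hB : ∀ y, ‖ψ y‖ ≤ B) {V : H →L[ℝ] H} (hℓ : ∀ y y', ℓ y y' = inner ℝ (ψ y) (V (ψ y')))
    {η : Kernel X Y} [IsMarkovKernel η] {w : HilbertTensor H G}
    (hw : ∀ᵐ x ∂ρX, ∫ y, ψ y ∂(η x) = tensorEval x w) {f : X → Y} (hf : Measurable f) :
    ∫ z, ℓ (f z.1) z.2 ∂(ρX ⊗ₘ η) = ∫ x, inner ℝ (ψ (f x)) (V (tensorEval x w)) ∂ρX := by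
  simp_rw [hℓ]
  have hint : Integrable (fun z : X × Y => inner ℝ (ψ (f z.1)) (V (ψ z.2))) (ρX ⊗ₘ η) := by
    refine .of_bound (C := B * (‖V‖ * B)) ?_ (.of_forall fun z => ?_)
    · exact (((hψ.comp_measurable hf).comp_measurable measurable_fst).inner
        (V.continuous.comp_stronglyMeasurable
          (hψ.comp_measurable measurable_snd))).aestronglyMeasurable
    · exact (norm_inner_le_norm _ _).trans (mul_le_mul (hB _) ((V.le_opNorm _).trans
        (mul_le_mul_of_nonneg_left (hB _) (norm_nonneg _))) (norm_nonneg _)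
        ((norm_nonneg _).trans (hB (f z.1))))
  rw [Measure.integral_compProd hint]
  refine integral_congr_ae ?_
  filter_upwards [hw] with x hx
  have hψint : Integrable ψ (η x) := .of_bound hψ.aestronglyMeasurable B (.of_forall hB)
  rw [integral_inner (V.integrable_comp hψint), ContinuousLinearMap.integral_comp_comm V hψint, hx]

theorem expectedRisk_eq {ℓ : Y → Y → ℝ} (hf : StronglyMeasurable (feature G : X → G)) {κ : ℝ}
    (hκ : ∀ x : X, ‖feature G x‖ ≤ κ) {ψ : Y → H} (hψ : StronglyMeasurable ψ) {B : ℝ}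
    (hB : ∀ y, ‖ψ y‖ ≤ B) {V : H →L[ℝ] H} (hℓ : ∀ y y', ℓ y y' = inner ℝ (ψ y) (V (ψ y')))
    {w : Fin T → HilbertTensor H G}
    (hw : ∀ t, ∀ᵐ x ∂ρX, ∫ y, ψ y ∂(η t x) = tensorEval x (w t))
    {f : X → Fin T → Y} (hfm : Measurable f) :
    expectedRisk ℓ (fun t => ρX ⊗ₘ η t) f =
      ∫ x, (T : ℝ)⁻¹ * ∑ t, inner ℝ (ψ (f x t)) (V (tensorEval x (w t))) ∂ρX := by
  have hft (t : Fin T) : Measurable fun x => f x t := (measurable_pi_apply t).comp hfm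
  rw [integral_const_mul, integral_finsetSum _ fun t _ =>
    integrable_inner_tensorEval hf hκ hψ hB V (w t) (hft t), expectedRisk]
  congr 1
  exact Finset.sum_congr rfl fun t _ => integral_loss_eq hψ hB hℓ (hw t) (hft t)

/-- Comparison inequality: the excess risk of a nonlinear multitask estimator is controlled by the
`L²` errors of the kernel ridge regressions. -/
theorem expectedRisk_sub_optimalRisk_le {ℓ : Y → Y → ℝ}
    (hf : StronglyMeasurable (feature G : X → G)) {κ : ℝ}
    (hκ : ∀ x : X, ‖feature G x‖ ≤ κ) {ψ : Y → H} (hψ : StronglyMeasurable ψ) {B : ℝ}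
    (hB : ∀ y, ‖ψ y‖ ≤ B) {V : H →L[ℝ] H} (hℓ : ∀ y y', ℓ y y' = inner ℝ (ψ y) (V (ψ y')))
    {w : Fin T → HilbertTensor H G}
    (hw : ∀ t, ∀ᵐ x ∂ρX, ∫ y, ψ y ∂(η t x) = tensorEval x (w t))
    {C : Set (Fin T → Y)} {n : Fin T → ℕ} {reg : Fin T → ℝ} {z : (t : Fin T) → Fin (n t) → X × Y}
    {f : X → Fin T → Y} (hfm : Measurable f)
    (hest : IsMTLEstimator ℓ (scalarKernel G) reg C z f) {D : ℝ} (hD : 0 < D)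
    (herr : ∀ t, ∫ x, ‖tensorEval x (krrTensor (G := G) (fun i => (z t i).1)
      (fun i => ψ (z t i).2) (reg t) - w t)‖ ^ 2 ∂ρX ≤ D ^ 2) :
    expectedRisk ℓ (fun t => ρX ⊗ₘ η t) f - optimalRisk ℓ (fun t => ρX ⊗ₘ η t) C ≤
      qConst ψ V C * D := by
  rw [sub_le_comm, optimalRisk]
  -- The estimator itself is a competitor, so the infimum does not range over an empty type.
  have : Nonempty {f : X → Fin T → Y // Measurable f ∧ ∀ x, f x ∈ C} :=
    ⟨f, hfm, fun x => (hest x).1⟩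
  refine le_ciInf fun ⟨f', hfm', hC'⟩ => ?_
  rw [sub_le_comm, expectedRisk_eq hf hκ hψ hB hℓ hw hfm, expectedRisk_eq hf hκ hψ hB hℓ hw hfm']
  have hint {f : X → Fin T → Y} (hfm : Measurable f) : Integrable (fun x =>
      (T : ℝ)⁻¹ * ∑ t, inner ℝ (ψ (f x t)) (V (tensorEval x (w t)))) ρX :=
    (integrable_finsetSum _ fun t _ => integrable_inner_tensorEval hf hκ hψ hB V (w t)
      ((measurable_pi_apply t).comp hfm)).const_mul _
  rw [← integral_sub (hint hfm) (hint hfm')]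
  set v : Fin T → HilbertTensor H G := fun t => krrTensor (G := G) (fun i => (z t i).1)
      (fun i => ψ (z t i).2) (reg t) - w t with hv
  set q := qConst ψ V C with hq
  have hq0 : 0 ≤ q := qConst_nonneg ψ V C
  have hvint (t : Fin T) : Integrable (fun x => ‖tensorEval x (v t)‖ ^ 2) ρX := by
    refine .of_bound (C := (κ * ‖v t‖) ^ 2)
      ((stronglyMeasurable_tensorEval hf (v t)).norm.pow 2).aestronglyMeasurable
      (.of_forall fun x => ?_)
    rw [norm_pow, norm_norm]
    exact pow_le_pow_left₀ (norm_nonneg _) (norm_tensorEval_apply_le hκ x _) 2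
  have hsint := (integrable_finsetSum Finset.univ fun t _ => hvint t).const_mul (T : ℝ)⁻¹
  -- The inequality `√s ≤ s / (2 * D) + D / 2` takes the place of Jensen's: the right side is
  -- integrable and integrates to at most `D`.
  have hpt (x : X) : (T : ℝ)⁻¹ * ∑ t, inner ℝ (ψ (f x t)) (V (tensorEval x (w t))) -
      (T : ℝ)⁻¹ * ∑ t, inner ℝ (ψ (f' x t)) (V (tensorEval x (w t))) ≤
      q * (((T : ℝ)⁻¹ * ∑ t, ‖tensorEval x (v t)‖ ^ 2) / (2 * D) + D / 2) := by
    have hsur (c : Fin T → Y) : ∑ t, ∑ i, krrWeights (scalarKernel G) (fun j => (z t j).1) (reg t) x i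
        * ℓ (c t) (z t i).2 = ∑ t, inner ℝ (ψ (c t)) (V (tensorEval x (krrTensor (G := G)
          (fun i => (z t i).1) (fun i => ψ (z t i).2) (reg t)))) := by
      refine Finset.sum_congr rfl fun t _ => ?_
      rw [tensorEval_krrTensor, map_sum, inner_sum]
      refine Finset.sum_congr rfl fun i _ => ?_
      rw [map_smul, inner_smul_right, hℓ]
    have hmin := isMinOn_iff.mp (hest x).2 (f' x) (hC' x)
    rw [hsur, hsur] at hmin
    refine (mean_inner_sub_le hB V (hest x).1 (hC' x) _ _ hmin).trans
      (mul_le_mul_of_nonneg_left ?_ hq0)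
    simp_rw [← map_sub]
    set s := (T : ℝ)⁻¹ * ∑ t, ‖tensorEval x (v t)‖ ^ 2
    have hs : 0 ≤ s := by positivity
    have h1 := Real.sq_sqrt hs
    have h2 : s / (2 * D) + D / 2 - √s = (√s - D) ^ 2 / (2 * D) := by
      rw [sub_sq, h1]; field_simp; ring
    have h3 : 0 ≤ (√s - D) ^ 2 / (2 * D) := by positivity
    linarith
  refine (integral_mono ((hint hfm).sub (hint hfm'))
    (((hsint.div_const (2 * D)).add (integrable_const (D / 2))).const_mul q) hpt).trans ?_
  rw [integral_const_mul, integral_add' (hsint.div_const _) (integrable_const _), integral_div,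
    integral_const_mul, integral_finsetSum _ fun t _ => hvint t]
  refine mul_le_mul_of_nonneg_left ?_ hq0
  have hmean : (T : ℝ)⁻¹ * ∑ t, ∫ x, ‖tensorEval x (v t)‖ ^ 2 ∂ρX ≤ D ^ 2 := by
    calc _ ≤ (T : ℝ)⁻¹ * ∑ _t : Fin T, D ^ 2 := by gcongr with t; exact herr t
      _ = ((T : ℝ)⁻¹ * T) * D ^ 2 := by simp [mul_assoc]
      _ ≤ 1 * D ^ 2 := by gcongr; exact inv_mul_le_one
      _ = D ^ 2 := one_mul _
  have h1 : (T : ℝ)⁻¹ * (∑ t, ∫ x, ‖tensorEval x (v t)‖ ^ 2 ∂ρX) / (2 * D) ≤ D / 2 := by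
    rw [div_le_iff₀ (by positivity)]
    linarith
  simp only [integral_const, probReal_univ, one_smul]
  linarith

end Risk

end NonlinearMTL

end

/-! ### Union bound and choice of constants. -/

theorem mainTheorem2
    -- the loss, given on `[a, b]` in SELF form
    (a b : ℝ) {H : Type*} [NormedAddCommGroup H] [InnerProductSpace ℝ H] [CompleteSpace H]
    (ℓ : Set.Icc a b → Set.Icc a b → ℝ) (ψ : Set.Icc a b → H) (V : H →L[ℝ] H)
    (hℓ : NonlinearMTL.IsSELF ℓ ψ V)
    -- the scalar reproducing kernel Hilbert space `G` on `X`, with a bounded measurable kernel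
    {X : Type*} [MeasurableSpace X] (G : Type*) [NormedAddCommGroup G] [InnerProductSpace ℝ G]
    [CompleteSpace G] [TopologicalSpace.SeparableSpace G] [RKHS ℝ G X ℝ]
    (hk_meas : ∀ x, Measurable (NonlinearMTL.scalarKernel G x : X → ℝ))
    (hk_bdd : BddAbove (Set.range fun x : X => NonlinearMTL.scalarKernel G x x))
    -- a bound for the norms of the regression functions in `H ⊗ G`
    (R : ℝ) :
    ∃ h : ℝ, 0 < h ∧
      ∀ (T : ℕ) (_ : 2 ≤ T) (C : Set (Fin T → Set.Icc a b))
        -- the common marginal on `X` and the conditional distributions of the tasks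
        (ρX : Measure X) [IsProbabilityMeasure ρX]
        (η : Fin T → Kernel X (Set.Icc a b)) [∀ t, IsMarkovKernel (η t)]
        -- the regression functions `x ↦ ∫ ψ(y) dρₜ(y | x)` belong to `H ⊗ G`
        (_ : ∀ t, ∃ w : NonlinearMTL.HilbertTensor H G, ‖w‖ ≤ R ∧
          ∀ᵐ x ∂ρX, ∫ y, ψ y ∂(η t x) = NonlinearMTL.tensorEval x w)
        (n : Fin T → ℕ) (_ : ∀ t, 1 ≤ n t)
        -- the training data, i.i.d. within each task
        (Ω : Type*) [MeasurableSpace Ω] (P : Measure Ω) [IsProbabilityMeasure P]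
        (Z : (t : Fin T) → Fin (n t) → Ω → X × Set.Icc a b)
        (_ : ∀ t i, Measurable (Z t i))
        (_ : ∀ t i, P.map (Z t i) = ρX ⊗ₘ η t)
        (_ : ∀ t, iIndepFun (Z t) P)
        (τ : ℝ) (_ : 0 < τ),
        ∃ A : Set Ω, MeasurableSet A ∧ 1 - 8 * Real.exp (-τ) ≤ P.real A ∧
          ∀ ω ∈ A, ∀ f : X → Fin T → Set.Icc a b, Measurable f →
            NonlinearMTL.IsMTLEstimator ℓ (NonlinearMTL.scalarKernel G)
              (fun t => (n t : ℝ) ^ (-(1 / 2) : ℝ)) C (fun t i => Z t i ω) f →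
            NonlinearMTL.expectedRisk ℓ (fun t => ρX ⊗ₘ η t) f -
                NonlinearMTL.optimalRisk ℓ (fun t => ρX ⊗ₘ η t) C ≤
              NonlinearMTL.qConst ψ V C * h * τ ^ 2 *
                ((⨅ t, n t : ℕ) : ℝ) ^ (-(1 / 4) : ℝ) * Real.log T := by
  obtain ⟨b₀, hb₀⟩ := hk_bdd
  have hκ (x : X) : ‖NonlinearMTL.feature G x‖ ≤ √(|b₀| + 1) := by
    refine Real.le_sqrt_of_sq_le ?_
    rw [NonlinearMTL.norm_feature_sq]
    linarith [hb₀ ⟨x, rfl⟩, le_abs_self b₀]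
  obtain ⟨B₀, hB₀⟩ := (isCompact_range hℓ.continuous_feature).isBounded.exists_norm_le
  have hB (y : Set.Icc a b) : ‖ψ y‖ ≤ |B₀| + 1 := by
    linarith [hB₀ _ ⟨y, rfl⟩, le_abs_self B₀]
  set κ : ℝ := √(|b₀| + 1)
  set B : ℝ := |B₀| + 1
  have hκ0 : 0 < κ := by positivity
  have hB0 : 0 < B := by positivity
  have hf := NonlinearMTL.stronglyMeasurable_feature (G := G) hk_meas
  have hψ : StronglyMeasurable ψ := hℓ.continuous_feature.stronglyMeasurable
  set K : ℝ := (2 * ((B + κ * R) * κ) + R) ^ 2 * (1 + 4 * κ ^ 2) with hK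
  have hK0 : 0 ≤ K := by positivity
  -- The summand 1 keeps the constant positive even if `K = 0`; the 3 comes from `τ + log T ≤ 3 * τ
  -- ^ 2 * log T`.
  refine ⟨3 * (√K + 1), by positivity, ?_⟩
  intro T hT C ρX _ η _ hreg n hn Ω _ P _ Z hZ hlaw hind τ hτ
  choose w hwR hw using hreg
  -- Below `log 8` the required probability is negative and the empty event serves; above it, `τ ≥
  -- 1`.
  rcases lt_or_ge τ (Real.log 8) with hτ8 | hτ8
  · refine ⟨∅, MeasurableSet.empty, ?_, fun ω hω => absurd hω (Set.notMem_empty ω)⟩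
    have h1 : Real.exp (-Real.log 8) ≤ Real.exp (-τ) := Real.exp_le_exp.mpr (by linarith)
    rw [Real.exp_neg, Real.exp_log (by norm_num)] at h1
    rw [measureReal_empty]
    linarith
  have hτ1 : 1 ≤ τ := by
    refine le_trans ?_ hτ8
    rw [Real.le_log_iff_exp_le (by norm_num)]
    linarith [Real.exp_one_lt_d9]
  have hT2 : (2 : ℝ) ≤ T := by exact_mod_cast hT
  have hlogT : 1 / 2 ≤ Real.log T :=
    le_trans (by linarith [Real.log_two_gt_d9]) (Real.log_le_log two_pos hT2)
  have hexp : Real.exp (-(τ + Real.log T)) = (T : ℝ)⁻¹ * Real.exp (-τ) := by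
    rw [neg_add, Real.exp_add, Real.exp_neg (Real.log T), Real.exp_log (by linarith), mul_comm]
  -- At level `τ + log T` each task fails with probability at most `4 * exp (-τ) / T`, so all `T`
  -- together with at most `4 * exp (-τ)`.
  choose A hAm hAP hA using fun t => NonlinearMTL.exists_krr_error_bound hf hκ hκ0 hψ hB0 hB
    (hwR t) (hw t) (hn t) (hZ t) (hlaw t) (hind t) (τ := τ + Real.log T) (by linarith)
  have hAi : MeasurableSet (⋂ t, A t) := MeasurableSet.iInter hAm
  refine ⟨⋂ t, A t, hAi, ?_, fun ω hω f hfm hest => ?_⟩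
  · have h1 : P.real (⋂ t, A t)ᶜ ≤ 4 * Real.exp (-τ) := by
      rw [Set.compl_iInter]
      refine (measureReal_iUnion_fintype_le _).trans
        ((Finset.sum_le_sum fun t _ => hAP t).trans (le_of_eq ?_))
      rw [hexp, Finset.sum_const, Finset.card_univ, Fintype.card_fin, nsmul_eq_mul]
      field_simp
    rw [probReal_compl_eq_one_sub hAi] at h1
    linarith [Real.exp_pos (-τ)]
  have hTne : Nonempty (Fin T) := ⟨⟨0, by omega⟩⟩
  have hm1 : 1 ≤ ⨅ t, n t := le_ciInf hn
  set m : ℕ := ⨅ t, n t with hm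
  have hm0 : (0 : ℝ) < m := by exact_mod_cast hm1
  have hpow : ((m : ℝ) ^ (-(1 / 4) : ℝ)) ^ 2 = (m : ℝ) ^ (-(1 / 2) : ℝ) := by
    rw [← Real.rpow_natCast, ← Real.rpow_mul hm0.le]
    norm_num
  have hm4 : 0 < (m : ℝ) ^ (-(1 / 4) : ℝ) := Real.rpow_pos_of_pos hm0 _
  have hτT : 0 < τ + Real.log T := by linarith
  refine (NonlinearMTL.expectedRisk_sub_optimalRisk_le hf hκ hψ hB hℓ.loss_eq hw hfm hest
    (D := (√K + 1) * (τ + Real.log T) * (m : ℝ) ^ (-(1 / 4) : ℝ)) (by positivity)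
    fun t => ?_).trans ?_
  · refine (hA t ω (Set.mem_iInter.mp hω t)).trans ?_
    have hnt : (n t : ℝ) ^ (-(1 / 2) : ℝ) ≤ (m : ℝ) ^ (-(1 / 2) : ℝ) := by
      refine Real.rpow_le_rpow_of_nonpos hm0 ?_ (by norm_num)
      exact_mod_cast ciInf_le (OrderBot.bddBelow _) t
    have hKs : K ≤ (√K + 1) ^ 2 := by nlinarith [Real.sq_sqrt hK0, Real.sqrt_nonneg K]
    rw [mul_pow, mul_pow, hpow]
    gcongr
  -- Here `τ ≤ τ ^ 2 ≤ 2 * τ ^ 2 * log T`, since `log T ≥ log 2 > 1 / 2`, and `log T ≤ τ ^ 2 * log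
  -- T`.
  · have h1 : τ + Real.log T ≤ 3 * (τ ^ 2 * Real.log T) := by
      have h2 : τ ≤ τ ^ 2 := by nlinarith
      have h3 : τ ^ 2 * (1 / 2) ≤ τ ^ 2 * Real.log T := by gcongr
      have h4 : 1 * Real.log T ≤ τ ^ 2 * Real.log T :=
        mul_le_mul_of_nonneg_right (by linarith) (by linarith)
      linarith
    have hq := NonlinearMTL.qConst_nonneg ψ V C
    calc NonlinearMTL.qConst ψ V C * ((√K + 1) * (τ + Real.log T) * (m : ℝ) ^ (-(1 / 4) : ℝ))
        ≤ NonlinearMTL.qConst ψ V C *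
          ((√K + 1) * (3 * (τ ^ 2 * Real.log T)) * (m : ℝ) ^ (-(1 / 4) : ℝ)) := by gcongr
      _ = _ := by ring
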